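/- Let $H,G$ be real Hilbert spaces, $M:H\to G$ a bounded linear operator, $f:H\to\mathbb R$ convex and differentiable with $L_f$-Lipschitz gradient ($L_f\ge 0$), and $g:H\to(-\infty,+\infty]$, $h:G\to(-\infty,+\infty]$ proper, lower semicontinuous and convex. Put $F(x)=f(x)+g(x)+h(Mx)$, $F^\star=\inf_H F$, and let $\mathcal P^\star$ be the set of minimizers of $F$. Let $S$ be a bounded self-adjoint operator on $G$ with $\langle y,Sy\rangle\ge s\|y\|^2$ for all $y$ and some $s>0$; put $\|y\|_S=\sqrt{\langle y,Sy\rangle}$, $\|y\|_{S^{-1}}=\sqrt{\langle y,S^{-1}y\rangle}$ and $\|M\|_{S^{-1}}=\sup_{x\ne0}\|Mx\|_{S^{-1}}/\|x\|$. Let $\dot y\in G$. For $\beta>0$ let $$h_\beta(y;\dot y)=\max_{z\in G}\Big\{\langle y,z\rangle-h^*(z)-\tfrac{\beta}{2}\|z-\dot y\|_S^2\Big\},$$ where $h^*$ is the Fenchel conjugate of $h$, let $y_\beta^*(y;\dot y)$ be the point where this maximum is attained, and let $F_\beta(x)=f(x)+g(x)+h_\beta(Mx;\dot y)$. For $\gamma>0$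 let $\mathrm{prox}_{\gamma g}(x)=\mathrm{argmin}_z\{\gamma g(z)+\frac12\|z-x\|^2\}$. In each of the following algorithms $\tau_0=1$, $\beta_0>0$, the points $\bar x^0,\tilde x^0\in H$ are arbitrary, and for $k=0,1,2,\dots$ $$\hat x^k=(1-\tau_k)\bar x^k+\tau_k\tilde x^k,\qquad \beta_{k+1}=\frac{\beta_k}{1+\tau_k},\qquad v^k=M^*y^*_{\beta_{k+1}}(M\hat x^k;\dot y),$$ $$\tilde x^{k+1}=\mathrm{prox}_{\frac1{\tau_kB_{k+1}}g}\Big(\tilde x^k-\tfrac1{\tau_kB_{k+1}}(d^k+v^k)\Big),\qquad \bar x^{k+1}=(1-\tau_k)\bar x^k+\tau_k\tilde x^{k+1}.$$ 1. Linearized ASGARD (assuming $L_f>0$ or $M\neq0$): $d^k=\nabla f(\hat x^k)$, $B_{k+1}=L_f+\|M\|_{S^{-1}}^2/\beta_{k+1}$, and $\tau_{k+1}$ is the unique positive root $t$ of $\frac{B_{k+1}-L_f}{B_{k+1}}t^3+t^2+\tau_k^2t-\tau_k^2=0$. 2. Linearized ASGARD with old gradients (assuming $L_f>0$): $B_{k+1}$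 and $\tau_{k+1}$ as in 1; further inputs are $\delta>0$, $\sigma>0$ and an arbitrary first reference point in $H$. In iteration $k$ one first computes $\tilde x^{k+1},\bar x^{k+1}$ with $d^k=\nabla f(r)$, where $r$ is the current reference point. If $\frac12\|\bar x^{k+1}-r\|^2-\frac12\|\bar x^{k+1}-\hat x^k\|^2\le\sigma\big(\tau_k^2B_{k+1}/L_f\big)^{2+\delta}$, these points are accepted and $r$ is kept for the next iteration; otherwise the reference point becomes $\hat x^k$, and $\tilde x^{k+1},\bar x^{k+1}$ are recomputed with $d^k=\nabla f(\hat x^k)$. 3. Linearized ASGARD with line search: $d^k=\nabla f(\hat x^k)$; further inputs are $a>1$ and $0<B_0\le a\big(L_f+\|M\|_{S^{-1}}^2/\beta_0\big)$. In iteration $k$ the values $B_{k+1}=B_k,aB_k,a^2B_k,\dots$ are tried in turn; for each of them $\tau_k$ is $1$ if $k=0$ and otherwise the unique positive solution of $\frac{1-\tau_k}{\tau_k^2B_{k+1}}=\frac1{\tau_{k-1}^2B_k}$, and $\hat x^k,\beta_{k+1},v^k,\tilde x^{k+1},\bar x^{k+1}$ are computed from it as above. The first value is accepted for which $$f(\bar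 x^{k+1})+h_{\beta_{k+1}}(M\bar x^{k+1};\dot y)\le f(\hat x^k)+h_{\beta_{k+1}}(M\hat x^k;\dot y)+\langle\nabla f(\hat x^k)+v^k,\bar x^{k+1}-\hat x^k\rangle+\tfrac{B_{k+1}}2\|\bar x^{k+1}-\hat x^k\|^2 .$$ Then for every $x^\star\in\mathcal P^\star$ and every $k\in\mathbb N=\{0,1,2,\dots\}$, $$F_{\beta_{k+1}}(\bar x^{k+1})-F^\star\le\begin{cases}\dfrac{B_1}{2(k+1)}\|x^\star-\tilde x^0\|^2&\text{for Algorithm 1},\\[2mm]\dfrac{B_1}{k+1}\Big(\dfrac12\|x^\star-\tilde x^0\|^2+\sigma\Big(\dfrac{B_1}{L_f}\Big)^{1+\delta}\zeta(1+\delta)\Big)&\text{for Algorithm 2},\\[2mm]\dfrac{B_1\beta_{k+1}}{\beta_0}\|x^\star-\tilde x^0\|^2&\text{for Algorithm 3},\end{cases}$$ where $\zeta(s)=\sum_{i=0}^\infty(i+1)^{-s}$. Moreover, for Algorithm 3 there is a constant $C$ that depends only on $f,g,h,M,L_f,S,\dot y,a,\beta_0$ such that $\frac{B_1\beta_{k+1}}{\beta_0}\|x^\star-\tilde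 x^0\|^2\le\frac{C}{k+1}\|x^\star-\tilde x^0\|^2$ for every run, every $x^\star\in\mathcal P^\star$ and every $k\in\mathbb N$. -/

import Mathlib

noncomputable section

namespace Asgard

/-- Properness of an extended-real-valued function with values in `(-∞, +∞]`. -/
def IsProper {E : Type*} (φ : E → EReal) : Prop :=
  (∀ x, φ x ≠ ⊥) ∧ ∃ x, φ x ≠ ⊤

/-- Convexity of a function with values in `(-∞, +∞]`. -/
def IsConvex {E : Type*} [AddCommGroup E] [Module ℝ E] (φ : E → EReal) : Prop :=
  ∀ x y : E, ∀ s t : ℝ, 0 < s → 0 < t → s + t = 1 →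
    φ (s • x + t • y) ≤ (s : EReal) * φ x + (t : EReal) * φ y

/-- `f` is differentiable and its gradient is `L`-Lipschitz, in the form of the quadratic upper
bound (equivalent to Lipschitz continuity of the gradient for convex `f`). -/
def HasLipschitzGradient {E : Type*} [NormedAddCommGroup E] [InnerProductSpace ℝ E]
    [CompleteSpace E] (f : E → ℝ) (L : ℝ) : Prop :=
  Differentiable ℝ f ∧
    ∀ x y : E, f x ≤ f y + inner ℝ (x - y) (gradient f y) + L / 2 * ‖x - y‖ ^ 2

/-- Positive definite (self-adjoint, coercive) operators. -/
def IsPositiveDefinite {E : Type*} [NormedAddCommGroup E] [InnerProductSpace ℝ E]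
    [CompleteSpace E] (S : E →L[ℝ] E) : Prop :=
  IsSelfAdjoint S ∧ ∃ σ : ℝ, 0 < σ ∧ ∀ y : E, σ * ‖y‖ ^ 2 ≤ inner ℝ y (S y)

/-- The norm `‖y‖_S = √⟨y, S y⟩`. -/
def weightedNorm {E : Type*} [NormedAddCommGroup E] [InnerProductSpace ℝ E]
    (S : E →L[ℝ] E) (y : E) : ℝ :=
  Real.sqrt (inner ℝ y (S y))

/-- `p = prox_φ (x)`: the point `p` minimizes `z ↦ φ z + ‖z - x‖² / 2`. -/
def IsProx {E : Type*} [NormedAddCommGroup E] (φ : E → EReal) (x p : E) : Prop :=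
  IsMinOn (fun z => φ z + ((1 / 2 * ‖z - x‖ ^ 2 : ℝ) : EReal)) Set.univ p

/-- The Fenchel-Moreau conjugate. -/
def conjugate {E : Type*} [NormedAddCommGroup E] [InnerProductSpace ℝ E]
    (h : E → EReal) (y : E) : EReal :=
  ⨆ z : E, ((inner ℝ z y : ℝ) : EReal) - h z

/-- The objective `z ↦ ⟨y, z⟩ - h^*(z) - (β / 2) ‖z - ẏ‖_S²` of the problem that defines the
smooth approximation of `h`. -/
def smoothObjective {E : Type*} [NormedAddCommGroup E] [InnerProductSpace ℝ E]
    (h : E → EReal) (S : E →L[ℝ] E) (ydot : E) (β : ℝ) (y z : E) : EReal :=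
  ((inner ℝ y z : ℝ) : EReal) - conjugate h z - ((β / 2 * weightedNorm S (z - ydot) ^ 2 : ℝ) : EReal)

/-- The `β`-smooth approximation `h_β(y; ẏ)` of `h`. -/
def smoothApprox {E : Type*} [NormedAddCommGroup E] [InnerProductSpace ℝ E]
    (h : E → EReal) (S : E →L[ℝ] E) (ydot : E) (β : ℝ) (y : E) : EReal :=
  ⨆ z : E, smoothObjective h S ydot β y z

/-- `z = y_β^*(y; ẏ)`: the point `z` attains the maximum that defines `h_β(y; ẏ)`. -/
def IsSmoothArgmax {E : Type*} [NormedAddCommGroup E] [InnerProductSpace ℝ E]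
    (h : E → EReal) (S : E →L[ℝ] E) (ydot : E) (β : ℝ) (y z : E) : Prop :=
  IsMaxOn (smoothObjective h S ydot β y) Set.univ z

/-- The data and standing assumptions of the problem `min_x f(x) + g(x) + h(Mx)`. -/
structure Problem (H G : Type*) [NormedAddCommGroup H] [InnerProductSpace ℝ H] [CompleteSpace H]
    [NormedAddCommGroup G] [InnerProductSpace ℝ G] [CompleteSpace G] where
  f : H → ℝ
  g : H → EReal
  h : G → EReal
  M : H →L[ℝ] G
  Lf : ℝ
  Lf_nonneg : 0 ≤ Lf
  f_convex : ConvexOn ℝ Set.univ f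
  f_gradient : HasLipschitzGradient f Lf
  g_proper : IsProper g
  g_convex : IsConvex g
  g_lsc : LowerSemicontinuous g
  h_proper : IsProper h
  h_convex : IsConvex h
  h_lsc : LowerSemicontinuous h

section Algorithms

variable {H G : Type*} [NormedAddCommGroup H] [InnerProductSpace ℝ H] [CompleteSpace H]
  [NormedAddCommGroup G] [InnerProductSpace ℝ G] [CompleteSpace G]

/-- The objective function `F = f + g + h ∘ M`. -/
def Problem.F (P : Problem H G) (x : H) : EReal :=
  (P.f x : EReal) + P.g x + P.h (P.M x)

/-- The optimal value `F^⋆`. -/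
def Problem.optVal (P : Problem H G) : EReal :=
  ⨅ x : H, P.F x

/-- The set of minimizers of `F`. -/
def Problem.minimizers (P : Problem H G) : Set H :=
  {x | IsMinOn P.F Set.univ x}

/-- The smoothed objective `F_β = f + g + h_β(M ·; ẏ)`. -/
def Problem.smoothF (P : Problem H G) (S : G →L[ℝ] G) (ydot : G) (β : ℝ) (x : H) : EReal :=
  (P.f x : EReal) + P.g x + smoothApprox P.h S ydot β (P.M x)

/-- The operator norm `‖M‖_{S⁻¹} = sup_{x ≠ 0} ‖M x‖_{S⁻¹} / ‖x‖`. -/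
def Problem.normM (P : Problem H G) (S : G →L[ℝ] G) : ℝ :=
  ⨆ x : {x : H // x ≠ 0}, weightedNorm (ContinuousLinearMap.inverse S) (P.M x) / ‖(x : H)‖

/-- The proximal gradient step `p = prox_{γ g} (u - γ d)`. -/
def Problem.IsProxStep (P : Problem H G) (γ : ℝ) (u d p : H) : Prop :=
  IsProx (fun z => (γ : EReal) * P.g z) (u - γ • d) p

/-- `τ'` is the positive root of `((B - L_f) / B) t³ + t² + τ² t - τ² = 0`. -/
def Problem.IsNextTau (P : Problem H G) (B τ τ' : ℝ) : Prop :=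
  0 < τ' ∧ (B - P.Lf) / B * τ' ^ 3 + τ' ^ 2 + τ ^ 2 * τ' - τ ^ 2 = 0

/-- The sequences are generated by the linearized ASGARD algorithm; `y k` is the point
`y_{β_{k+1}}^*(M x̂^k; ẏ)`, and `B 0` is not used. -/
structure IsLinearized (P : Problem H G) (S : G →L[ℝ] G) (ydot : G)
    (τ β B : ℕ → ℝ) (xbar xtilde xhat : ℕ → H) (y : ℕ → G) : Prop where
  tau_zero : τ 0 = 1
  beta_zero : 0 < β 0
  hat : ∀ k, xhat k = (1 - τ k) • xbar k + τ k • xtilde k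
  beta_succ : ∀ k, β (k + 1) = β k / (1 + τ k)
  B_succ : ∀ k, B (k + 1) = P.Lf + P.normM S ^ 2 / β (k + 1)
  dual : ∀ k, IsSmoothArgmax P.h S ydot (β (k + 1)) (P.M (xhat k)) (y k)
  tilde_succ : ∀ k, P.IsProxStep (1 / (τ k * B (k + 1))) (xtilde k)
    (gradient P.f (xhat k) + ContinuousLinearMap.adjoint P.M (y k)) (xtilde (k + 1))
  bar_succ : ∀ k, xbar (k + 1) = (1 - τ k) • xbar k + τ k • xtilde (k + 1)
  tau_succ : ∀ k, P.IsNextTau (B (k + 1)) (τ k) (τ (k + 1))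

/-- The acceptance test for old gradients: `xold` is the point where the gradient of `f` was
taken, `xbar'` is the resulting candidate for the next main iterate. -/
def Problem.OldGradientTest (P : Problem H G) (σ δ τ B : ℝ) (xhat xold xbar' : H) : Prop :=
  1 / 2 * ‖xbar' - xold‖ ^ 2 - 1 / 2 * ‖xbar' - xhat‖ ^ 2 ≤ σ * (τ ^ 2 * B / P.Lf) ^ (2 + δ)

/-- The sequences are generated by the linearized ASGARD algorithm with old gradients.
`xold k` is the gradient reference point stored when iteration `k` starts (`xold 0` is an input)
and `xtrial k` is the proximal point computed from it in iteration `k`. If the corresponding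
candidate passes the test, it is accepted and the reference point is kept; otherwise the reference
point becomes `xhat k` and the proximal step is recomputed with the gradient of `f` at `xhat k`. -/
structure IsOldGradient (P : Problem H G) (S : G →L[ℝ] G) (ydot : G) (σ δ : ℝ)
    (τ β B : ℕ → ℝ) (xbar xtilde xhat xold xtrial : ℕ → H) (y : ℕ → G) : Prop where
  tau_zero : τ 0 = 1
  beta_zero : 0 < β 0
  hat : ∀ k, xhat k = (1 - τ k) • xbar k + τ k • xtilde k
  beta_succ : ∀ k, β (k + 1) = β k / (1 + τ k)
  B_succ : ∀ k, B (k + 1) = P.Lf + P.normM S ^ 2 / β (k + 1)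
  dual : ∀ k, IsSmoothArgmax P.h S ydot (β (k + 1)) (P.M (xhat k)) (y k)
  trial : ∀ k, P.IsProxStep (1 / (τ k * B (k + 1))) (xtilde k)
    (gradient P.f (xold k) + ContinuousLinearMap.adjoint P.M (y k)) (xtrial k)
  accept : ∀ k,
    P.OldGradientTest σ δ (τ k) (B (k + 1)) (xhat k) (xold k)
        ((1 - τ k) • xbar k + τ k • xtrial k) →
      xold (k + 1) = xold k ∧ xtilde (k + 1) = xtrial k
  reject : ∀ k,
    ¬ P.OldGradientTest σ δ (τ k) (B (k + 1)) (xhat k) (xold k)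
        ((1 - τ k) • xbar k + τ k • xtrial k) →
      xold (k + 1) = xhat k ∧
        P.IsProxStep (1 / (τ k * B (k + 1))) (xtilde k)
          (gradient P.f (xhat k) + ContinuousLinearMap.adjoint P.M (y k)) (xtilde (k + 1))
  bar_succ : ∀ k, xbar (k + 1) = (1 - τ k) • xbar k + τ k • xtilde (k + 1)
  tau_succ : ∀ k, P.IsNextTau (B (k + 1)) (τ k) (τ (k + 1))

/-- The quantities computed in one pass through the line search loop. -/
structure Trial (H G : Type*) where
  B : ℝ
  τ : ℝ
  β : ℝ
  xhat : H
  y : G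
  xtilde : H
  xbar : H

/-- The trial `t` is what one pass of the line search loop computes with the estimate `t.B`, from
the current values `β`, `xbar`, `xtilde`; the requirement on the step parameter is `tauRule`. -/
structure Trial.IsComputed (t : Trial H G) (P : Problem H G) (S : G →L[ℝ] G) (ydot : G)
    (tauRule : ℝ → ℝ → Prop) (β : ℝ) (xbar xtilde : H) : Prop where
  tau : tauRule t.B t.τ
  hat : t.xhat = (1 - t.τ) • xbar + t.τ • xtilde
  beta : t.β = β / (1 + t.τ)
  dual : IsSmoothArgmax P.h S ydot t.β (P.M t.xhat) t.y
  tilde : P.IsProxStep (1 / (t.τ * t.B)) xtilde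
    (gradient P.f t.xhat + ContinuousLinearMap.adjoint P.M t.y) t.xtilde
  bar : t.xbar = (1 - t.τ) • xbar + t.τ • t.xtilde

/-- The stopping test of the line search. -/
def Trial.Passes (t : Trial H G) (P : Problem H G) (S : G →L[ℝ] G) (ydot : G) : Prop :=
  (P.f t.xbar : EReal) + smoothApprox P.h S ydot t.β (P.M t.xbar) ≤
    (P.f t.xhat : EReal) + smoothApprox P.h S ydot t.β (P.M t.xhat) +
      ((inner ℝ (gradient P.f t.xhat + ContinuousLinearMap.adjoint P.M t.y) (t.xbar - t.xhat) +
        t.B / 2 * ‖t.xbar - t.xhat‖ ^ 2 : ℝ) : EReal)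

/-- The rule for `τ_k` in iteration `k` of the line search variant: `τ_0 = 1`, and for `k ≥ 1`,
`τ_k` is the positive solution of `(1 - τ_k) / (τ_k² B_{k+1}) = 1 / (τ_{k-1}² B_k)`. -/
def lineSearchTau (τ B : ℕ → ℝ) : ℕ → ℝ → ℝ → Prop
  | 0, _, t => t = 1
  | k + 1, B', t => 0 < t ∧ (1 - t) / (t ^ 2 * B') = 1 / (τ k ^ 2 * B (k + 1))

/-- The sequences are generated by the linearized ASGARD algorithm with line search: in iteration
`k` the estimates `B_k, a B_k, a² B_k, …` are tried, and the first one that passes the test is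
accepted. -/
structure IsLineSearch (P : Problem H G) (S : G →L[ℝ] G) (ydot : G) (a : ℝ)
    (τ β B : ℕ → ℝ) (xbar xtilde xhat : ℕ → H) (y : ℕ → G) : Prop where
  one_lt_a : 1 < a
  beta_zero : 0 < β 0
  B_zero_pos : 0 < B 0
  B_zero_le : B 0 ≤ a * (P.Lf + P.normM S ^ 2 / β 0)
  step : ∀ k, ∃ n : ℕ,
    B (k + 1) = a ^ n * B k ∧
    (∀ m < n, ∃ t : Trial H G, t.B = a ^ m * B k ∧
      t.IsComputed P S ydot (lineSearchTau τ B k) (β k) (xbar k) (xtilde k) ∧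
      ¬ t.Passes P S ydot) ∧
    (⟨B (k + 1), τ k, β (k + 1), xhat k, y k, xtilde (k + 1), xbar (k + 1)⟩ :
      Trial H G).IsComputed P S ydot (lineSearchTau τ B k) (β k) (xbar k) (xtilde k) ∧
    (⟨B (k + 1), τ k, β (k + 1), xhat k, y k, xtilde (k + 1), xbar (k + 1)⟩ :
      Trial H G).Passes P S ydot

end Algorithms

end Asgard

end

/-
The function maximized in the definition of `h_β` is strongly concave, with modulus `β` in the norm
`‖·‖_S`. Hence the smooth part `f + h_β(M ·)` has a quadratic upper model at `x̂^k`, built from the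
affine minorant `f(r) + ⟨∇f(r), · - r⟩ + ⟨M ·, y⟩ - h^*(y)` of `f + h ∘ M`. Combining this model
with the three-point inequality of the proximal step and the convexity of `g` gives, for every `x`,
  `F_{β_{k+1}}(x̄^{k+1}) ≤ (1 - τ_k) F_{β_k}(x̄^k) + τ_k F(x)
      + τ_k² B_{k+1} / 2 (‖x - x̃^k‖² - ‖x - x̃^{k+1}‖²) + ε_k`;
passing from `β_{k+1}` to `β_k = (1 + τ_k) β_{k+1}` costs nothing because `1 - τ_k² ≤ 1`. All three
parameter rules make the weights `τ_k² B_{k+1}` satisfy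
`τ_{k+1}² B_{k+2} = (1 - τ_{k+1}) τ_k² B_{k+1}`, so after division by the weights the inequalities
telescope, and only the decay of the weights and the sum of the errors `ε_k` remain to be bounded.
-/

namespace Asgard

open Filter
open scoped Topology InnerProductSpace InnerProduct

section Convexity

theorem IsConvex.const_mul {E : Type*} [AddCommGroup E] [Module ℝ E] {φ : E → EReal}
    (hφ : IsConvex φ) {γ : ℝ} (hγ : 0 ≤ γ) : IsConvex fun z => (γ : EReal) * φ z := by
  intro x y s t hs ht hst
  have hγ' : (0 : EReal) ≤ γ := EReal.coe_nonneg.2 hγ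
  calc (γ : EReal) * φ (s • x + t • y)
      ≤ γ * (s * φ x + t * φ y) := mul_le_mul_of_nonneg_left (hφ x y s t hs ht hst) hγ'
    _ = s * (γ * φ x) + t * (γ * φ y) := by
        rw [EReal.left_distrib_of_nonneg_of_ne_top hγ' (EReal.coe_ne_top γ), mul_left_comm,
          mul_left_comm (γ : EReal) t]

theorem IsConvex.add_linear {E : Type*} [AddCommGroup E] [Module ℝ E] {φ : E → EReal}
    (hφ : IsConvex φ) (l : E →ₗ[ℝ] ℝ) : IsConvex fun z => φ z + (l z : EReal) := by
  intro x y s t hs ht hst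
  have hl : ((l (s • x + t • y) : ℝ) : EReal) = s * (l x : EReal) + t * (l y : EReal) := by
    rw [map_add, map_smul, map_smul]
    norm_cast
  calc φ (s • x + t • y) + (l (s • x + t • y) : EReal)
      ≤ (s * φ x + t * φ y) + (s * (l x : EReal) + t * (l y : EReal)) :=
        add_le_add (hφ x y s t hs ht hst) hl.le
    _ = s * (φ x + l x) + t * (φ y + l y) := by
        rw [EReal.left_distrib_of_nonneg_of_ne_top (EReal.coe_nonneg.2 hs.le) (EReal.coe_ne_top s),
          EReal.left_distrib_of_nonneg_of_ne_top (EReal.coe_nonneg.2 ht.le) (EReal.coe_ne_top t),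
          add_add_add_comm]

theorem IsConvex.apply_combo_le {E : Type*} [AddCommGroup E] [Module ℝ E] {φ : E → EReal}
    (hφ : IsConvex φ) {x y : E} {a b s t : ℝ} (hx : φ x ≤ a) (hy : φ y ≤ b) (hs : 0 ≤ s)
    (ht : 0 ≤ t) (hst : s + t = 1) : φ (s • x + t • y) ≤ ((s * a + t * b : ℝ) : EReal) := by
  rcases hs.eq_or_lt with rfl | hs
  · obtain rfl : t = 1 := by linarith
    simpa using hy
  rcases ht.eq_or_lt with rfl | ht
  · obtain rfl : s = 1 := by linarith
    simpa using hx
  calc φ (s • x + t • y) ≤ s * φ x + t * φ y := hφ x y s t hs ht hst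
    _ ≤ s * (a : EReal) + t * (b : EReal) :=
        add_le_add (mul_le_mul_of_nonneg_left hx (EReal.coe_nonneg.2 hs.le))
          (mul_le_mul_of_nonneg_left hy (EReal.coe_nonneg.2 ht.le))
    _ = ((s * a + t * b : ℝ) : EReal) := by norm_cast

variable {E : Type*} [NormedAddCommGroup E] [InnerProductSpace ℝ E]

theorem add_inner_gradient_le [CompleteSpace E] {s : Set E} {f : E → ℝ} (hf : ConvexOn ℝ s f)
    {x y : E} (hx : x ∈ s) (hy : y ∈ s) (hd : DifferentiableAt ℝ f y) :
    f y + ⟪x - y, gradient f y⟫_ℝ ≤ f x := by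
  have hline : ConvexOn ℝ (AffineMap.lineMap y x ⁻¹' s) (f ∘ AffineMap.lineMap y x) :=
    hf.comp_affineMap (AffineMap.lineMap y x : ℝ →ᵃ[ℝ] E)
  have hderiv : HasDerivAt (f ∘ AffineMap.lineMap y x) ⟪gradient f y, x - y⟫_ℝ (0 : ℝ) := by
    have hgrad : HasFDerivAt f (InnerProductSpace.toDual ℝ E (gradient f y))
        (AffineMap.lineMap y x (0 : ℝ)) := by
      simpa using hd.hasGradientAt.hasFDerivAt
    exact hgrad.comp_hasDerivAt (0 : ℝ) AffineMap.hasDerivAt_lineMap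
  have hslope := hline.le_slope_of_hasDerivAt (by simpa using hy) (by simpa using hx) zero_lt_one
    hderiv
  rw [real_inner_comm] at hslope
  simp only [slope, Function.comp_apply, AffineMap.lineMap_apply_one, AffineMap.lineMap_apply_zero,
    sub_zero, inv_one, one_smul, vsub_eq_sub] at hslope
  linarith

theorem add_le_of_forall_mem_Ioo {a b m : ℝ}
    (h : ∀ t ∈ Set.Ioo (0 : ℝ) 1, a + (1 - t) * m ≤ b) : a + m ≤ b := by
  have hlim : Tendsto (fun t : ℝ => a + (1 - t) * m) (𝓝[>] 0) (𝓝 (a + m)) := by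
    have hcont : Continuous fun t : ℝ => a + (1 - t) * m := by fun_prop
    simpa using (hcont.tendsto 0).mono_left nhdsWithin_le_nhds
  exact le_of_tendsto hlim (eventually_of_mem (Ioo_mem_nhdsGT one_pos) h)

theorem exists_coe_of_add_coe_le {a : EReal} (ha : a ≠ ⊥) {r R : ℝ}
    (h : a + (r : EReal) ≤ (R : EReal)) : ∃ q : ℝ, a = q ∧ q + r ≤ R := by
  induction a with
  | bot => exact absurd rfl ha
  | top => simp at h
  | coe q => exact ⟨q, rfl, by exact_mod_cast h⟩

theorem inner_map_combo {S : E →L[ℝ] E} (hS : S.IsSymmetric) (x y : E) (t : ℝ) :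
    ⟪(1 - t) • x + t • y, S ((1 - t) • x + t • y)⟫_ℝ =
      (1 - t) * ⟪x, S x⟫_ℝ + t * ⟪y, S y⟫_ℝ - t * (1 - t) * ⟪y - x, S (y - x)⟫_ℝ := by
  have hcomm : ⟪y, S x⟫_ℝ = ⟪x, S y⟫_ℝ := by rw [real_inner_comm, hS.apply_clm x y]
  simp only [map_add, map_sub, map_smul, inner_add_left, inner_add_right, inner_sub_left,
    inner_sub_right, real_inner_smul_left, real_inner_smul_right, hcomm]
  ring

theorem add_quadratic_le_of_isMinOn {φ : E → EReal} (hφ : IsConvex φ) (hbot : ∀ z, φ z ≠ ⊥)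
    {S : E →L[ℝ] E} (hS : S.IsSymmetric) {c p : E}
    (hp : IsMinOn (fun z => φ z + ((1 / 2 * ⟪z - c, S (z - c)⟫_ℝ : ℝ) : EReal)) Set.univ p)
    (z : E) :
    φ p + ((1 / 2 * ⟪p - c, S (p - c)⟫_ℝ + 1 / 2 * ⟪z - p, S (z - p)⟫_ℝ : ℝ) : EReal) ≤
      φ z + ((1 / 2 * ⟪z - c, S (z - c)⟫_ℝ : ℝ) : EReal) := by
  rw [isMinOn_univ_iff] at hp
  by_cases hz : φ z = ⊤
  · rw [hz, EReal.top_add_coe]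
    exact le_top
  obtain ⟨r, hr⟩ : ∃ r : ℝ, φ z = r := ⟨_, (EReal.coe_toReal hz (hbot z)).symm⟩
  have hpz := hp z
  rw [hr, ← EReal.coe_add] at hpz
  obtain ⟨q, hq, -⟩ := exists_coe_of_add_coe_le (hbot p) hpz
  rw [hr, hq, ← EReal.coe_add, ← EReal.coe_add, EReal.coe_le_coe_iff, ← add_assoc]
  refine add_le_of_forall_mem_Ioo fun t ⟨ht0, ht1⟩ => ?_
  have hsegment := (hp ((1 - t) • p + t • z)).trans (add_le_add_left
    (hφ.apply_combo_le hq.le hr.le (sub_nonneg.2 ht1.le) ht0.le (by ring)) _)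
  rw [hq, show (1 - t) • p + t • z - c = (1 - t) • (p - c) + t • (z - c) by module,
    inner_map_combo hS, sub_sub_sub_cancel_right, ← EReal.coe_add, ← EReal.coe_add,
    EReal.coe_le_coe_iff] at hsegment
  refine le_of_mul_le_mul_left ?_ ht0
  linarith

end Convexity

section WeightedNorm

variable {G : Type*} [NormedAddCommGroup G] [InnerProductSpace ℝ G]

theorem weightedNorm_le (T : G →L[ℝ] G) (y : G) : weightedNorm T y ≤ √‖T‖ * ‖y‖ := by
  refine Real.sqrt_le_iff.2 ⟨by positivity, ?_⟩
  rw [mul_pow, Real.sq_sqrt (norm_nonneg T)]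
  calc ⟪y, T y⟫_ℝ ≤ ‖y‖ * ‖T y‖ := real_inner_le_norm _ _
    _ ≤ ‖y‖ * (‖T‖ * ‖y‖) := by gcongr; exact T.le_opNorm y
    _ = ‖T‖ * ‖y‖ ^ 2 := by ring

namespace IsPositiveDefinite

variable [CompleteSpace G] {S : G →L[ℝ] G} (hS : IsPositiveDefinite S)
include hS

theorem weightedNorm_sq (y : G) : weightedNorm S y ^ 2 = ⟪y, S y⟫_ℝ := by
  obtain ⟨σ, hσ, h⟩ := hS.2
  exact Real.sq_sqrt ((by positivity : 0 ≤ σ * ‖y‖ ^ 2).trans (h y))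

theorem weightedNorm_pos {y : G} (hy : y ≠ 0) : 0 < weightedNorm S y := by
  obtain ⟨σ, hσ, h⟩ := hS.2
  exact Real.sqrt_pos.2 ((by positivity : 0 < σ * ‖y‖ ^ 2).trans_le (h y))

theorem apply_inverse (y : G) : S (S.inverse y) = y := by
  obtain ⟨σ, hσ, h⟩ := hS.2
  have hunit : IsUnit S :=
    S.isUnit_of_forall_le_norm_inner_map (c := ⟨σ, hσ.le⟩) hσ fun y => by
      rw [Real.norm_eq_abs, real_inner_comm]
      exact (mul_comm _ _).trans_le ((h y).trans (le_abs_self _))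
  obtain ⟨u, rfl⟩ := hunit
  exact ContinuousLinearMap.IsInvertible.self_apply_inverse
    ⟨ContinuousLinearEquiv.unitsEquiv ℝ G u, by ext; simp⟩ y

theorem weightedNorm_inverse (u : G) : weightedNorm S.inverse u = weightedNorm S (S.inverse u) := by
  rw [weightedNorm, weightedNorm, hS.apply_inverse, real_inner_comm]

theorem weightedNorm_inverse_pos {u : G} (hu : u ≠ 0) : 0 < weightedNorm S.inverse u := by
  rw [hS.weightedNorm_inverse]
  refine hS.weightedNorm_pos fun h => hu ?_
  rw [← hS.apply_inverse u, h, map_zero]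

theorem inner_le_weightedNorm_add {β : ℝ} (hβ : 0 < β) (u w : G) :
    ⟪u, w⟫_ℝ ≤ β / 2 * weightedNorm S w ^ 2 + 1 / (2 * β) * weightedNorm S.inverse u ^ 2 := by
  have hnonneg := sq_nonneg (weightedNorm S (S.inverse u - β • w))
  have hexpand : weightedNorm S (S.inverse u - β • w) ^ 2 =
      weightedNorm S.inverse u ^ 2 - 2 * β * ⟪u, w⟫_ℝ + β ^ 2 * weightedNorm S w ^ 2 := by
    have hcross : ⟪S.inverse u, S w⟫_ℝ = ⟪u, w⟫_ℝ := by
      rw [← hS.1.isSymmetric.apply_clm, hS.apply_inverse]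
    rw [hS.weightedNorm_inverse]
    simp only [hS.weightedNorm_sq, map_sub, map_smul, hS.apply_inverse, inner_sub_left,
      inner_sub_right, real_inner_smul_left, real_inner_smul_right, hcross, real_inner_comm u w]
    ring
  rw [hexpand] at hnonneg
  field_simp
  linarith

end IsPositiveDefinite

variable {H : Type*} [NormedAddCommGroup H] [InnerProductSpace ℝ H] [CompleteSpace H]
  [CompleteSpace G]

theorem Problem.weightedNorm_map_le (P : Problem H G) (S : G →L[ℝ] G) (x : H) :
    weightedNorm S.inverse (P.M x) ≤ P.normM S * ‖x‖ := by
  rcases eq_or_ne x 0 with rfl | hx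
  · simp [weightedNorm]
  rw [← div_le_iff₀ (norm_pos_iff.2 hx)]
  refine le_ciSup (f := fun x : {x : H // x ≠ 0} =>
    weightedNorm S.inverse (P.M x) / ‖(x : H)‖) ⟨√‖S.inverse‖ * ‖P.M‖, ?_⟩ ⟨x, hx⟩
  rintro _ ⟨⟨z, hz⟩, rfl⟩
  refine (div_le_iff₀ (norm_pos_iff.2 hz)).2 ((weightedNorm_le _ _).trans ?_)
  rw [mul_assoc]
  gcongr
  exact P.M.le_opNorm z

theorem Problem.normM_pos (P : Problem H G) {S : G →L[ℝ] G} (hS : IsPositiveDefinite S)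
    (hM : P.M ≠ 0) : 0 < P.normM S := by
  obtain ⟨x, hx⟩ : ∃ x, P.M x ≠ 0 := by
    by_contra! h
    exact hM (ContinuousLinearMap.ext h)
  exact pos_of_mul_pos_left ((hS.weightedNorm_inverse_pos hx).trans_le (P.weightedNorm_map_le S x))
    (norm_nonneg x)

end WeightedNorm

section Smoothing

variable {G : Type*} [NormedAddCommGroup G] [InnerProductSpace ℝ G] {h : G → EReal}

theorem inner_sub_le_conjugate (h : G → EReal) (u z : G) :
    ((⟪u, z⟫_ℝ : ℝ) : EReal) - h u ≤ conjugate h z :=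
  le_iSup (fun u : G => ((⟪u, z⟫_ℝ : ℝ) : EReal) - h u) u

theorem inner_sub_conjugate_le (h : G → EReal) (u z : G) :
    ((⟪u, z⟫_ℝ : ℝ) : EReal) - conjugate h z ≤ h u := by
  have hle := inner_sub_le_conjugate h u z
  induction hu : h u with
  | top => exact le_top
  | bot =>
    rw [hu, EReal.coe_sub_bot, top_le_iff] at hle
    rw [hle, EReal.sub_top]
  | coe r =>
    rw [hu, EReal.sub_le_iff_le_add (by simp) (by simp), add_comm] at hle
    exact EReal.sub_le_of_le_add hle

theorem conjugate_ne_bot (hh : ∃ u, h u ≠ ⊤) (z : G) : conjugate h z ≠ ⊥ := by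
  obtain ⟨u, hu⟩ := hh
  refine ne_bot_of_le_ne_bot ?_ (inner_sub_le_conjugate h u z)
  simpa [sub_eq_add_neg, EReal.add_ne_bot_iff] using hu

theorem isConvex_conjugate (h : G → EReal) : IsConvex (conjugate h) := by
  intro x y s t hs ht hst
  have hs' : (0 : EReal) ≤ s := EReal.coe_nonneg.2 hs.le
  have ht' : (0 : EReal) ≤ t := EReal.coe_nonneg.2 ht.le
  refine iSup_le fun u => le_trans ?_ (add_le_add
    (mul_le_mul_of_nonneg_left (inner_sub_le_conjugate h u x) hs')
    (mul_le_mul_of_nonneg_left (inner_sub_le_conjugate h u y) ht'))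
  induction h u with
  | bot => simp [EReal.coe_mul_top_of_pos hs, EReal.coe_mul_top_of_pos ht]
  | top => simp
  | coe r =>
    norm_cast
    rw [inner_add_right, real_inner_smul_right, real_inner_smul_right]
    exact le_of_eq (by linear_combination r * hst)

variable {S : G →L[ℝ] G} {ydot : G} {β : ℝ}

theorem smoothObjective_add_left (u w z : G) :
    smoothObjective h S ydot β (u + w) z =
      smoothObjective h S ydot β u z + ((⟪w, z⟫_ℝ : ℝ) : EReal) := by
  rw [smoothObjective, smoothObjective, inner_add_left, EReal.coe_add]
  generalize β / 2 * weightedNorm S (z - ydot) ^ 2 = r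
  simp only [sub_eq_add_neg]
  ac_rfl

theorem neg_add_coe (a : EReal) (r : ℝ) : -(a + (r : EReal)) = -a - (r : EReal) :=
  EReal.neg_add (.inr (EReal.coe_ne_top r)) (.inr (EReal.coe_ne_bot r))

theorem smoothApprox_le (hβ : 0 ≤ β) (u : G) : smoothApprox h S ydot β u ≤ h u := by
  refine iSup_le fun z => le_trans ?_ (inner_sub_conjugate_le h u z)
  refine (EReal.sub_le_sub le_rfl (EReal.coe_nonneg.2 ?_)).trans (sub_zero _).le
  positivity

theorem IsSmoothArgmax.smoothApprox_eq {v y : G} (hy : IsSmoothArgmax h S ydot β v y) :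
    smoothApprox h S ydot β v = smoothObjective h S ydot β v y :=
  le_antisymm (iSup_le fun _ => hy (Set.mem_univ _)) (le_iSup _ y)

variable [CompleteSpace G]

theorem smoothObjective_eq_neg (hS : IsPositiveDefinite S) (v z : G) :
    smoothObjective h S ydot β v z = -(conjugate h z + ((-⟪v, z⟫_ℝ : ℝ) : EReal) +
      ((1 / 2 * ⟪z - ydot, (β • S) (z - ydot)⟫_ℝ : ℝ) : EReal)) := by
  have hquad : β / 2 * weightedNorm S (z - ydot) ^ 2 =
      1 / 2 * ⟪z - ydot, (β • S) (z - ydot)⟫_ℝ := by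
    rw [hS.weightedNorm_sq, smul_apply, real_inner_smul_right]
    ring
  rw [smoothObjective, hquad, neg_add_coe, neg_add_coe, EReal.coe_neg,
    sub_eq_add_neg (-_) (-_), neg_neg, add_comm (-_), ← sub_eq_add_neg]

theorem IsSmoothArgmax.smoothObjective_add_le (hh : ∃ u, h u ≠ ⊤) (hS : IsPositiveDefinite S)
    {v y : G} (hy : IsSmoothArgmax h S ydot β v y) (z : G) :
    smoothObjective h S ydot β v z + ((β / 2 * weightedNorm S (z - y) ^ 2 : ℝ) : EReal) ≤
      smoothObjective h S ydot β v y := by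
  have hconvex : IsConvex fun z => conjugate h z + ((-⟪v, z⟫_ℝ : ℝ) : EReal) :=
    (isConvex_conjugate h).add_linear (-(innerSL ℝ v).toLinearMap)
  have hbot : ∀ z, conjugate h z + ((-⟪v, z⟫_ℝ : ℝ) : EReal) ≠ ⊥ := fun z =>
    EReal.add_ne_bot_iff.2 ⟨conjugate_ne_bot hh z, EReal.coe_ne_bot _⟩
  have hsymm : ((β • S : G →L[ℝ] G)).IsSymmetric := hS.1.isSymmetric.smul (by simp)
  have hmin : IsMinOn (fun z => conjugate h z + ((-⟪v, z⟫_ℝ : ℝ) : EReal) +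
      ((1 / 2 * ⟪z - ydot, (β • S) (z - ydot)⟫_ℝ : ℝ) : EReal)) Set.univ y := by
    refine isMinOn_univ_iff.2 fun z => ?_
    rw [← EReal.neg_le_neg_iff, ← smoothObjective_eq_neg hS, ← smoothObjective_eq_neg hS]
    exact hy (Set.mem_univ z)
  have hgrowth := add_quadratic_le_of_isMinOn hconvex hbot hsymm hmin z
  have hquad : β / 2 * weightedNorm S (z - y) ^ 2 = 1 / 2 * ⟪z - y, (β • S) (z - y)⟫_ℝ := by
    rw [hS.weightedNorm_sq, smul_apply, real_inner_smul_right]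
    ring
  rw [EReal.coe_add, ← add_assoc, ← EReal.neg_le_neg_iff, neg_add_coe (_ + _ + _),
    ← smoothObjective_eq_neg hS, ← smoothObjective_eq_neg hS, ← hquad] at hgrowth
  rwa [← EReal.le_sub_iff_add_le (.inl (EReal.coe_ne_bot _)) (.inl (EReal.coe_ne_top _))]

theorem IsSmoothArgmax.smoothApprox_le_add (hh : ∃ u, h u ≠ ⊤) (hS : IsPositiveDefinite S)
    (hβ : 0 < β) {v y : G} (hy : IsSmoothArgmax h S ydot β v y) (u : G) :
    smoothApprox h S ydot β u ≤ smoothObjective h S ydot β u y +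
      ((1 / (2 * β) * weightedNorm S.inverse (u - v) ^ 2 : ℝ) : EReal) := by
  refine iSup_le fun z => ?_
  have hyoung := hS.inner_le_weightedNorm_add hβ (u - v) (z - y)
  rw [inner_sub_right] at hyoung
  have hshift : ∀ w, smoothObjective h S ydot β u w =
      smoothObjective h S ydot β v w + ((⟪u - v, w⟫_ℝ : ℝ) : EReal) := fun w => by
    rw [← smoothObjective_add_left, add_sub_cancel]
  calc smoothObjective h S ydot β u z
      ≤ smoothObjective h S ydot β v z + ((β / 2 * weightedNorm S (z - y) ^ 2 +
          (⟪u - v, y⟫_ℝ + 1 / (2 * β) * weightedNorm S.inverse (u - v) ^ 2) : ℝ) : EReal) := by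
        rw [hshift]
        gcongr
        linarith
    _ ≤ smoothObjective h S ydot β v y +
          ((⟪u - v, y⟫_ℝ + 1 / (2 * β) * weightedNorm S.inverse (u - v) ^ 2 : ℝ) : EReal) := by
        rw [EReal.coe_add, ← add_assoc]
        gcongr
        exact hy.smoothObjective_add_le hh hS z
    _ = smoothObjective h S ydot β u y +
          ((1 / (2 * β) * weightedNorm S.inverse (u - v) ^ 2 : ℝ) : EReal) := by
        rw [hshift, EReal.coe_add, add_assoc]

end Smoothing

section AcceleratedStep

variable {H G : Type*} [NormedAddCommGroup H] [InnerProductSpace ℝ H] [CompleteSpace H]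
  [NormedAddCommGroup G] [InnerProductSpace ℝ G] [CompleteSpace G]
  {P : Problem H G} {S : G →L[ℝ] G} {ydot : G} {τ β B ε : ℝ}

/-- The quadratic upper model at `x` of the smooth part `f + h_β(M ·; ẏ)`: `f` is linearized at
`r`, the maximum defining `h_β` is replaced by its value at `y`, and the error is controlled by
`B / 2 ‖x - xhat‖² + ε`. It is what the line search tests and what drives all three algorithms. -/
def Problem.HasUpperModel (P : Problem H G) (S : G →L[ℝ] G) (ydot : G) (β B ε : ℝ) (xhat r : H)
    (y : G) (x : H) : Prop :=
  (P.f x : EReal) + smoothApprox P.h S ydot β (P.M x) ≤ smoothObjective P.h S ydot β (P.M x) y +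
    ((P.f r + ⟪x - r, gradient P.f r⟫_ℝ + B / 2 * ‖x - xhat‖ ^ 2 + ε : ℝ) : EReal)

theorem Problem.hasUpperModel_of_isSmoothArgmax (hS : IsPositiveDefinite S) (hβ : 0 < β)
    {xhat r x : H} {y : G} (hy : IsSmoothArgmax P.h S ydot β (P.M xhat) y)
    (hB : P.Lf + P.normM S ^ 2 / β ≤ B)
    (hε : P.Lf / 2 * ‖x - r‖ ^ 2 ≤ P.Lf / 2 * ‖x - xhat‖ ^ 2 + ε) :
    P.HasUpperModel S ydot β B ε xhat r y x := by
  have hf := P.f_gradient.2 x r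
  have hh := hy.smoothApprox_le_add P.h_proper.2 hS hβ (P.M x)
  have hM : 1 / (2 * β) * weightedNorm S.inverse (P.M x - P.M xhat) ^ 2 ≤
      P.normM S ^ 2 / β / 2 * ‖x - xhat‖ ^ 2 := by
    rw [← map_sub]
    calc 1 / (2 * β) * weightedNorm S.inverse (P.M (x - xhat)) ^ 2
        ≤ 1 / (2 * β) * (P.normM S * ‖x - xhat‖) ^ 2 := by
          gcongr
          · exact Real.sqrt_nonneg _
          · exact P.weightedNorm_map_le S _
      _ = P.normM S ^ 2 / β / 2 * ‖x - xhat‖ ^ 2 := by field_simp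
  have hL := mul_le_mul_of_nonneg_right hB (sq_nonneg ‖x - xhat‖)
  calc (P.f x : EReal) + smoothApprox P.h S ydot β (P.M x)
      ≤ P.f x + (smoothObjective P.h S ydot β (P.M x) y +
          ((1 / (2 * β) * weightedNorm S.inverse (P.M x - P.M xhat) ^ 2 : ℝ) : EReal)) := by gcongr
    _ = smoothObjective P.h S ydot β (P.M x) y +
          ((P.f x + 1 / (2 * β) * weightedNorm S.inverse (P.M x - P.M xhat) ^ 2 : ℝ) : EReal) := by
        rw [add_left_comm, EReal.coe_add]
    _ ≤ _ := add_le_add_right (EReal.coe_le_coe_iff.2 (by linarith)) _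

theorem Trial.passes_iff {t : Trial H G} (hy : IsSmoothArgmax P.h S ydot t.β (P.M t.xhat) t.y) :
    t.Passes P S ydot ↔ P.HasUpperModel S ydot t.β t.B 0 t.xhat t.xhat t.y t.xbar := by
  have hshift : smoothObjective P.h S ydot t.β (P.M t.xbar) t.y =
      smoothApprox P.h S ydot t.β (P.M t.xhat) +
        ((⟪P.M (t.xbar - t.xhat), t.y⟫_ℝ : ℝ) : EReal) := by
    rw [hy.smoothApprox_eq, ← smoothObjective_add_left, ← map_add, add_sub_cancel]
  have hinner : ⟪gradient P.f t.xhat + (P.M†) t.y, t.xbar - t.xhat⟫_ℝ =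
      ⟪P.M (t.xbar - t.xhat), t.y⟫_ℝ + ⟪t.xbar - t.xhat, gradient P.f t.xhat⟫_ℝ := by
    rw [inner_add_left, ContinuousLinearMap.adjoint_inner_left, real_inner_comm,
      real_inner_comm t.y, add_comm]
  rw [Trial.Passes, Problem.HasUpperModel, hshift, hinner]
  simp only [EReal.coe_add, add_zero]
  refine iff_of_eq ?_
  ac_rfl

theorem Trial.passes_of_le (hS : IsPositiveDefinite S) {t : Trial H G} (hβ : 0 < t.β)
    (hy : IsSmoothArgmax P.h S ydot t.β (P.M t.xhat) t.y)
    (hB : P.Lf + P.normM S ^ 2 / t.β ≤ t.B) : t.Passes P S ydot :=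
  (Trial.passes_iff hy).2 <|
    Problem.hasUpperModel_of_isSmoothArgmax hS hβ hy hB (add_zero _).ge

theorem Problem.IsProxStep.exists_three_point {L : ℝ} (hL : 0 < L) {u d p x : H}
    (hp : P.IsProxStep (1 / L) u d p) {r : ℝ} (hx : P.g x = r) :
    ∃ q : ℝ, P.g p = q ∧
      q + ⟪d, p - x⟫_ℝ + L / 2 * ‖p - u‖ ^ 2 + L / 2 * ‖x - p‖ ^ 2 ≤ r + L / 2 * ‖x - u‖ ^ 2 := by
  have hgrowth := add_quadratic_le_of_isMinOn (S := ContinuousLinearMap.id ℝ H)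
    (P.g_convex.const_mul (one_div_pos.2 hL).le)
    (fun z => by simp [EReal.mul_eq_bot, P.g_proper.1 z, hL.le]) (fun _ _ => rfl)
    (by simpa only [Problem.IsProxStep, IsProx, ContinuousLinearMap.id_apply,
      real_inner_self_eq_norm_sq] using hp) x
  simp only [ContinuousLinearMap.id_apply, real_inner_self_eq_norm_sq, hx, ← EReal.coe_mul,
    ← EReal.coe_add] at hgrowth
  obtain ⟨q, hq, hle⟩ := exists_coe_of_add_coe_le
    (by simp [EReal.mul_eq_bot, P.g_proper.1 p, hL.le]) hgrowth
  refine ⟨L * q, ?_, ?_⟩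
  · rw [EReal.coe_mul, ← hq, ← mul_assoc, ← EReal.coe_mul, mul_one_div_cancel hL.ne',
      EReal.coe_one, one_mul]
  have hexpand : ∀ z, ‖z - (u - (1 / L) • d)‖ ^ 2 =
      ‖z - u‖ ^ 2 + 2 / L * ⟪d, z - u⟫_ℝ + ‖(1 / L) • d‖ ^ 2 := fun z => by
    rw [← sub_add, norm_add_sq_real, real_inner_smul_right, real_inner_comm]
    ring
  rw [hexpand, hexpand] at hle
  rw [← sub_sub_sub_cancel_right p x u, inner_sub_right]
  have hscaled := mul_le_mul_of_nonneg_left hle hL.le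
  field_simp at hscaled ⊢
  linarith

/-- The affine minorant of `f + h ∘ M` obtained by linearizing `f` at `r` and bounding `h` below by
its supporting function with slope `y` (Fenchel-Young). It is meaningful only if `h^*(y)` is
finite. -/
noncomputable def Problem.affineModel (P : Problem H G) (r : H) (y : G) (x : H) : ℝ :=
  P.f r + ⟪x - r, gradient P.f r⟫_ℝ + ⟪P.M x, y⟫_ℝ - (conjugate P.h y).toReal

theorem Problem.affineModel_combo (P : Problem H G) (r : H) (y : G) (x z : H) (t : ℝ) :
    P.affineModel r y ((1 - t) • x + t • z) =
      (1 - t) * P.affineModel r y x + t * P.affineModel r y z := by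
  have hr : (1 - t) • x + t • z - r = (1 - t) • (x - r) + t • (z - r) := by module
  simp only [Problem.affineModel, hr, map_add, map_smul, inner_add_left, real_inner_smul_left]
  ring

theorem Problem.affineModel_eq_add (P : Problem H G) (r : H) (y : G) (x z : H) :
    P.affineModel r y z = P.affineModel r y x + ⟪gradient P.f r + (P.M†) y, z - x⟫_ℝ := by
  rw [inner_add_left, ContinuousLinearMap.adjoint_inner_left, real_inner_comm,
    real_inner_comm _ y, ← sub_sub_sub_cancel_right z x r, map_sub, map_sub, map_sub]
  simp only [Problem.affineModel, inner_sub_left]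
  ring

theorem Problem.smoothObjective_add_linearization (P : Problem H G) (S : G →L[ℝ] G) (ydot : G)
    (β : ℝ) {y : G} (hy : conjugate P.h y ≠ ⊤) (r x : H) (c : ℝ) :
    smoothObjective P.h S ydot β (P.M x) y +
        ((P.f r + ⟪x - r, gradient P.f r⟫_ℝ + c : ℝ) : EReal) =
      ((P.affineModel r y x - β / 2 * weightedNorm S (y - ydot) ^ 2 + c : ℝ) : EReal) := by
  rw [smoothObjective, Problem.affineModel,
    ← EReal.coe_toReal hy (conjugate_ne_bot P.h_proper.2 y)]
  norm_cast
  rw [EReal.toReal_coe]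
  ring

theorem Problem.exists_g_eq_of_smoothF_le (P : Problem H G) {y : G} (hy : conjugate P.h y ≠ ⊤)
    (r : H) {x : H} {v : ℝ} (hx : P.smoothF S ydot β x ≤ v) :
    ∃ q : ℝ, P.g x = q ∧
      q + (P.affineModel r y x - β / 2 * weightedNorm S (y - ydot) ^ 2) ≤ v := by
  have hlinear : P.f r + ⟪x - r, gradient P.f r⟫_ℝ ≤ P.f x :=
    add_inner_gradient_le P.f_convex (Set.mem_univ x) (Set.mem_univ r) (P.f_gradient.1 r)
  refine exists_coe_of_add_coe_le (P.g_proper.1 x) (le_trans ?_ hx)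
  rw [← add_zero (_ - _), ← P.smoothObjective_add_linearization S ydot β hy, add_zero,
    Problem.smoothF, add_comm (P.f x : EReal), add_assoc, add_comm (P.f x : EReal)]
  gcongr
  exact le_iSup (smoothObjective P.h S ydot β (P.M x)) y

theorem Problem.smoothF_le_F (P : Problem H G) (hβ : 0 ≤ β) (x : H) :
    P.smoothF S ydot β x ≤ P.F x :=
  add_le_add_right (smoothApprox_le hβ (P.M x)) _

/-- One iteration of any of the three algorithms, with step parameter `τ`, smoothness parameter
`β` and curvature estimate `B`, from `(xbar, xtilde)` to `(xbar', xtilde')`: a proximal step along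
`∇f(r) + M^* y` whose outcome satisfies the upper model with the same `r` and `y` up to an
error `ε`. -/
structure Problem.IsAcceleratedStep (P : Problem H G) (S : G →L[ℝ] G) (ydot : G) (τ β B ε : ℝ)
    (xbar xtilde xbar' xtilde' : H) : Prop where
  bar : xbar' = (1 - τ) • xbar + τ • xtilde'
  exists_model : ∃ (r : H) (y : G),
    P.IsProxStep (1 / (τ * B)) xtilde (gradient P.f r + (P.M†) y) xtilde' ∧
      P.HasUpperModel S ydot β B ε ((1 - τ) • xbar + τ • xtilde) r y xbar'

theorem Problem.IsAcceleratedStep.smoothF_le (hτ : 0 < τ) (hτ1 : τ ≤ 1) (hB : 0 < B) (hβ : 0 ≤ β)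
    {xbar xtilde xbar' xtilde' x : H} {Φ v : ℝ}
    (hstep : P.IsAcceleratedStep S ydot τ β B ε xbar xtilde xbar' xtilde')
    (hbar : P.smoothF S ydot (β * (1 + τ)) xbar ≤ Φ) (hx : P.F x ≤ v) :
    P.smoothF S ydot β xbar' ≤ (((1 - τ) * Φ + τ * v +
      τ ^ 2 * B / 2 * (‖x - xtilde‖ ^ 2 - ‖x - xtilde'‖ ^ 2) + ε : ℝ) : EReal) := by
  obtain ⟨hbar', r, y, hprox, hmodel⟩ := hstep
  rw [Problem.HasUpperModel] at hmodel
  rw [Problem.smoothF, add_right_comm]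
  by_cases hy : conjugate P.h y = ⊤
  · have hbot : (P.f xbar' : EReal) + smoothApprox P.h S ydot β (P.M xbar') = ⊥ := by
      simpa [smoothObjective, hy] using hmodel
    simp [hbot]
  rw [add_assoc _ (_ * _), P.smoothObjective_add_linearization S ydot β hy] at hmodel
  obtain ⟨gbar, hgbar, hlowbar⟩ := P.exists_g_eq_of_smoothF_le hy r hbar
  obtain ⟨gx, hgx, hlowx⟩ :=
    P.exists_g_eq_of_smoothF_le hy r ((P.smoothF_le_F (S := S) (ydot := ydot) le_rfl x).trans hx)
  obtain ⟨gp, hgp, hthree⟩ := hprox.exists_three_point (by positivity) hgx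
  have hg : P.g xbar' ≤ (((1 - τ) * gbar + τ * gp : ℝ) : EReal) := by
    rw [hbar']
    exact P.g_convex.apply_combo_le hgbar.le hgp.le (sub_nonneg.2 hτ1) hτ.le (by ring)
  refine (add_le_add hmodel hg).trans ?_
  rw [← EReal.coe_add, EReal.coe_le_coe_iff]
  have hmove : xbar' - ((1 - τ) • xbar + τ • xtilde) = τ • (xtilde' - xtilde) := by
    rw [hbar']
    module
  have haffine := P.affineModel_combo r y xbar xtilde' τ
  rw [P.affineModel_eq_add r y x xtilde', ← hbar'] at haffine
  -- The terms in `‖y - ydot‖_S²` cancel up to this one, since `1 - (1 - τ) * (1 + τ) = τ ^ 2`.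
  have hdual : 0 ≤ τ ^ 2 * (β / 2 * weightedNorm S (y - ydot) ^ 2) := by positivity
  have hlowbar' := mul_le_mul_of_nonneg_left hlowbar (sub_nonneg.2 hτ1)
  have hlowx' := mul_le_mul_of_nonneg_left hlowx hτ.le
  have hthree' := mul_le_mul_of_nonneg_left hthree hτ.le
  rw [hmove, norm_smul, mul_pow, Real.norm_eq_abs, sq_abs, haffine]
  linarith

end AcceleratedStep

section Schedule

/-- The relations between step parameters, smoothness parameters and curvature estimates shared by
the three algorithms. The quantity `τ_k² B_{k+1}` is the weight with which the initial distance
enters the bound after iteration `k`. -/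
structure IsAcceleratedSchedule (τ β B : ℕ → ℝ) : Prop where
  tau_zero : τ 0 = 1
  tau_pos : ∀ k, 0 < τ k
  beta_zero : 0 < β 0
  beta_succ : ∀ k, β (k + 1) = β k / (1 + τ k)
  B_pos : ∀ k, 0 < B (k + 1)
  weight_succ : ∀ k, τ (k + 1) ^ 2 * B (k + 2) = (1 - τ (k + 1)) * (τ k ^ 2 * B (k + 1))

namespace IsAcceleratedSchedule

variable {τ β B : ℕ → ℝ} (hs : IsAcceleratedSchedule τ β B)
include hs

theorem weight_pos (k : ℕ) : 0 < τ k ^ 2 * B (k + 1) :=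
  mul_pos (pow_pos (hs.tau_pos k) 2) (hs.B_pos k)

theorem tau_le_one : ∀ k, τ k ≤ 1
  | 0 => hs.tau_zero.le
  | k + 1 => by
    have hpos := hs.weight_pos (k + 1)
    rw [hs.weight_succ k] at hpos
    exact sub_nonneg.1 (pos_of_mul_pos_left hpos (hs.weight_pos k).le).le

theorem beta_pos : ∀ k, 0 < β k
  | 0 => hs.beta_zero
  | k + 1 => by
    rw [hs.beta_succ]
    have := hs.tau_pos k
    exact div_pos (beta_pos k) (by positivity)

theorem beta_eq_mul (k : ℕ) : β k = β (k + 1) * (1 + τ k) := by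
  rw [hs.beta_succ, div_mul_cancel₀]
  linarith [hs.tau_pos k]

theorem beta_succ_le (k : ℕ) : β (k + 1) ≤ β k := by
  rw [hs.beta_eq_mul k]
  exact le_mul_of_one_le_right (hs.beta_pos _).le (by linarith [hs.tau_pos k])

theorem beta_zero_eq : β 0 = 2 * β 1 := by
  rw [hs.beta_eq_mul 0, hs.tau_zero]
  ring

theorem weight_le (k : ℕ) : τ k ^ 2 * B (k + 1) ≤ 2 * (B 1 * β (k + 1) / β 0) := by
  induction k with
  | zero =>
    have := hs.beta_pos 1
    rw [hs.tau_zero, hs.beta_zero_eq]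
    field_simp
    rfl
  | succ k ih =>
    have hβ := hs.beta_pos (k + 2)
    have hβ₀ := hs.beta_zero
    have hB := hs.B_pos 0
    rw [hs.weight_succ k]
    calc (1 - τ (k + 1)) * (τ k ^ 2 * B (k + 1))
        ≤ (1 - τ (k + 1)) * (2 * (B 1 * β (k + 1) / β 0)) :=
          mul_le_mul_of_nonneg_left ih (sub_nonneg.2 (hs.tau_le_one _))
      _ = (1 - τ (k + 1) ^ 2) * (2 * (B 1 * β (k + 2) / β 0)) := by
          rw [hs.beta_eq_mul (k + 1)]
          ring
      _ ≤ 2 * (B 1 * β (k + 2) / β 0) :=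
          mul_le_of_le_one_left (by positivity) (by linarith [sq_nonneg (τ (k + 1))])

theorem weight_le_div (hτ : ∀ k : ℕ, 1 / ((k : ℝ) + 1) ≤ τ k) (k : ℕ) :
    τ k ^ 2 * B (k + 1) ≤ B 1 / ((k : ℝ) + 1) := by
  induction k with
  | zero => simp [hs.tau_zero]
  | succ k ih =>
    have hτk := hτ (k + 1)
    push_cast at hτk ⊢
    rw [hs.weight_succ k]
    calc (1 - τ (k + 1)) * (τ k ^ 2 * B (k + 1))
        ≤ (1 - 1 / ((k : ℝ) + 1 + 1)) * (B 1 / ((k : ℝ) + 1)) := by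
          gcongr
          · exact (hs.weight_pos k).le
          · linarith [hs.tau_le_one (k + 1)]
      _ = B 1 / ((k : ℝ) + 1 + 1) := by
          field_simp
          ring

theorem tau_mul_le_two (hB : ∀ k, B (k + 1) ≤ B (k + 2)) (k : ℕ) : τ k * ((k : ℝ) + 2) ≤ 2 := by
  induction k with
  | zero => simp [hs.tau_zero]
  | succ k ih =>
    have hτ := hs.tau_pos k
    have hτ' := hs.tau_pos (k + 1)
    have hsq : τ (k + 1) ^ 2 ≤ (1 - τ (k + 1)) * τ k ^ 2 := by
      refine le_of_mul_le_mul_right ?_ (hs.B_pos (k + 1))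
      rw [hs.weight_succ k, mul_assoc]
      gcongr
      · exact sub_nonneg.2 (hs.tau_le_one _)
      · exact hB k
    have hsq' : τ (k + 1) ^ 2 * ((k : ℝ) + 2) ^ 2 ≤ (1 - τ (k + 1)) * 4 := by
      calc τ (k + 1) ^ 2 * ((k : ℝ) + 2) ^ 2 ≤ (1 - τ (k + 1)) * τ k ^ 2 * ((k : ℝ) + 2) ^ 2 := by
            gcongr
        _ = (1 - τ (k + 1)) * (τ k * ((k : ℝ) + 2)) ^ 2 := by ring
        _ ≤ (1 - τ (k + 1)) * 2 ^ 2 := by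
            gcongr
            exact sub_nonneg.2 (hs.tau_le_one _)
        _ = (1 - τ (k + 1)) * 4 := by norm_num
    push_cast
    by_contra! hlt
    have hlt_sq : (2 - τ (k + 1)) ^ 2 < (τ (k + 1) * ((k : ℝ) + 2)) ^ 2 :=
      pow_lt_pow_left₀ (by linarith) (by linarith [hs.tau_le_one (k + 1)]) two_ne_zero
    linarith [pow_pos hτ' 2]

-- The rational factor is the product of `1 - (2 / (i + 2)) ^ 2` over `1 ≤ i ≤ k`.
theorem le_weight (hB : ∀ k, B (k + 1) ≤ B (k + 2)) (k : ℕ) :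
    2 * (B 1 * β (k + 1) / β 0) *
      (((k : ℝ) + 3) * ((k : ℝ) + 4) / (6 * ((k : ℝ) + 1) * ((k : ℝ) + 2))) ≤
        τ k ^ 2 * B (k + 1) := by
  induction k with
  | zero =>
    have := hs.beta_pos 1
    rw [hs.tau_zero, hs.beta_zero_eq]
    apply le_of_eq
    push_cast
    field_simp
    ring
  | succ k ih =>
    have hβ := hs.beta_pos (k + 2)
    have hβ₀ := hs.beta_zero
    have hB₁ := hs.B_pos 0
    have hτ : τ (k + 1) ≤ 2 / ((k : ℝ) + 3) := by
      rw [le_div_iff₀ (by positivity)]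
      have := hs.tau_mul_le_two hB (k + 1)
      push_cast at this
      linarith
    have hfactor : 1 - (2 / ((k : ℝ) + 3)) ^ 2 ≤ 1 - τ (k + 1) ^ 2 := by
      have := hs.tau_pos (k + 1)
      gcongr
    rw [hs.weight_succ k]
    calc 2 * (B 1 * β (k + 2) / β 0) * ((((k + 1 : ℕ) : ℝ) + 3) * (((k + 1 : ℕ) : ℝ) + 4) /
          (6 * (((k + 1 : ℕ) : ℝ) + 1) * (((k + 1 : ℕ) : ℝ) + 2)))
        = (1 - (2 / ((k : ℝ) + 3)) ^ 2) * (2 * (B 1 * β (k + 2) / β 0) *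
            (((k : ℝ) + 3) * ((k : ℝ) + 4) / (6 * ((k : ℝ) + 1) * ((k : ℝ) + 2)))) := by
          push_cast
          field_simp
          ring
      _ ≤ (1 - τ (k + 1) ^ 2) * (2 * (B 1 * β (k + 2) / β 0) *
            (((k : ℝ) + 3) * ((k : ℝ) + 4) / (6 * ((k : ℝ) + 1) * ((k : ℝ) + 2)))) :=
          mul_le_mul_of_nonneg_right hfactor (by positivity)
      _ = (1 - τ (k + 1)) * (2 * (B 1 * β (k + 1) / β 0) *
            (((k : ℝ) + 3) * ((k : ℝ) + 4) / (6 * ((k : ℝ) + 1) * ((k : ℝ) + 2)))) := by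
          rw [hs.beta_eq_mul (k + 1)]
          ring
      _ ≤ (1 - τ (k + 1)) * (τ k ^ 2 * B (k + 1)) :=
          mul_le_mul_of_nonneg_left ih (sub_nonneg.2 (hs.tau_le_one _))

theorem mul_beta_le_mul_tau {D : ℝ} (hB : ∀ k, B (k + 1) ≤ B (k + 2))
    (hD : ∀ k, B (k + 1) * β (k + 1) ≤ D) (k : ℕ) : B 1 * β (k + 1) ≤ 3 * D * τ k := by
  have hτ := hs.tau_pos k
  have hβ := hs.beta_pos (k + 1)
  have hβ₀ := hs.beta_zero
  have hB₁ := hs.B_pos 0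
  have hD₀ : 0 < D := (mul_pos hB₁ (hs.beta_pos 1)).trans_le (hD 0)
  have hweight : B 1 * β (k + 1) / (3 * β 0) ≤ τ k ^ 2 * B (k + 1) := by
    refine le_trans ?_ (hs.le_weight hB k)
    have hratio : 1 / 6 ≤ ((k : ℝ) + 3) * ((k : ℝ) + 4) / (6 * ((k : ℝ) + 1) * ((k : ℝ) + 2)) := by
      rw [div_le_div_iff₀ (by norm_num) (by positivity)]
      nlinarith
    calc B 1 * β (k + 1) / (3 * β 0) = 2 * (B 1 * β (k + 1) / β 0) * (1 / 6) := by
          field_simp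
          norm_num
      _ ≤ _ := by gcongr
  have hB₁β₀ : B 1 * β 0 ≤ 2 * D := by
    rw [hs.beta_zero_eq]
    linarith [hD 0]
  refine (pow_le_pow_iff_left₀ (by positivity) (by positivity) two_ne_zero).1 ?_
  calc (B 1 * β (k + 1)) ^ 2
      = B 1 * β (k + 1) / (3 * β 0) * (3 * (B 1 * β 0) * β (k + 1)) := by field_simp
    _ ≤ τ k ^ 2 * B (k + 1) * (3 * (2 * D) * β (k + 1)) := by
        gcongr
        exact (hs.weight_pos k).le
    _ = 6 * D * τ k ^ 2 * (B (k + 1) * β (k + 1)) := by ring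
    _ ≤ 6 * D * τ k ^ 2 * D := by
        gcongr
        exact hD k
    _ ≤ (3 * D * τ k) ^ 2 := by linarith [sq_nonneg (D * τ k)]

theorem mul_beta_le {D : ℝ} (hB : ∀ k, B (k + 1) ≤ B (k + 2))
    (hD : ∀ k, B (k + 1) * β (k + 1) ≤ D) (k : ℕ) :
    B 1 * β (k + 1) ≤ 6 * D / ((k : ℝ) + 1) := by
  have hτ := hs.tau_pos k
  have hD₀ : 0 < D := (mul_pos (hs.B_pos 0) (hs.beta_pos 1)).trans_le (hD 0)
  rw [le_div_iff₀ (by positivity)]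
  calc B 1 * β (k + 1) * ((k : ℝ) + 1) ≤ 3 * D * τ k * ((k : ℝ) + 1) :=
        mul_le_mul_of_nonneg_right (hs.mul_beta_le_mul_tau hB hD k) (by positivity)
    _ ≤ 3 * D * τ k * ((k : ℝ) + 2) := by
        gcongr
        norm_num
    _ = 3 * D * (τ k * ((k : ℝ) + 2)) := by ring
    _ ≤ 3 * D * 2 := by
        gcongr
        exact hs.tau_mul_le_two hB k
    _ = 6 * D := by ring

variable {H G : Type*} [NormedAddCommGroup H] [InnerProductSpace ℝ H] [CompleteSpace H]
  [NormedAddCommGroup G] [InnerProductSpace ℝ G] [CompleteSpace G]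
  {P : Problem H G} {S : G →L[ℝ] G} {ydot : G} {ε : ℕ → ℝ} {xbar xtilde : ℕ → H}
  (hstep : ∀ k, P.IsAcceleratedStep S ydot (τ k) (β (k + 1)) (B (k + 1)) (ε k)
    (xbar k) (xtilde k) (xbar (k + 1)) (xtilde (k + 1)))
include hstep

theorem smoothF_le_of_F_le {x : H} {v : ℝ} (hv : P.F x ≤ v) (k : ℕ) :
    P.smoothF S ydot (β (k + 1)) (xbar (k + 1)) ≤
      ((v + τ k ^ 2 * B (k + 1) * (1 / 2 * ‖x - xtilde 0‖ ^ 2 - 1 / 2 * ‖x - xtilde (k + 1)‖ ^ 2 +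
        ∑ i ∈ Finset.range (k + 1), ε i / (τ i ^ 2 * B (i + 1))) : ℝ) : EReal) := by
  have hdescent (k : ℕ) {Φ : ℝ} {z : H}
      (hz : P.IsAcceleratedStep S ydot (τ k) (β (k + 1)) (B (k + 1)) (ε k)
        z (xtilde k) (xbar (k + 1)) (xtilde (k + 1)))
      (hΦ : P.smoothF S ydot (β k) z ≤ Φ) := by
    rw [hs.beta_eq_mul k] at hΦ
    exact hz.smoothF_le (hs.tau_pos k) (hs.tau_le_one k) (hs.B_pos k) (hs.beta_pos _).le hΦ hv
  induction k with
  | zero =>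
    -- Since `τ 0 = 1`, the first step does not depend on `xbar 0`, which may be moved to `x`.
    have hfrom_x : P.IsAcceleratedStep S ydot (τ 0) (β 1) (B 1) (ε 0)
        x (xtilde 0) (xbar 1) (xtilde 1) := by
      have h := hstep 0
      rw [hs.tau_zero] at h ⊢
      exact ⟨by simpa using h.bar, by simpa using h.exists_model⟩
    refine (hdescent 0 hfrom_x ((P.smoothF_le_F hs.beta_zero.le x).trans hv)).trans
      (EReal.coe_le_coe_iff.2 (le_of_eq ?_))
    have hB := (hs.B_pos 0).ne'
    rw [hs.tau_zero, Finset.sum_range_one, hs.tau_zero]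
    field_simp
    ring
  | succ k ih =>
    refine (hdescent (k + 1) (hstep (k + 1)) ih).trans (EReal.coe_le_coe_iff.2 (le_of_eq ?_))
    have hε : τ (k + 1) ^ 2 * B (k + 2) * (ε (k + 1) / (τ (k + 1) ^ 2 * B (k + 2))) = ε (k + 1) :=
      mul_div_cancel₀ _ (hs.weight_pos (k + 1)).ne'
    rw [Finset.sum_range_succ _ (k + 1)]
    linear_combination -(1 / 2 * ‖x - xtilde 0‖ ^ 2 - 1 / 2 * ‖x - xtilde (k + 1)‖ ^ 2 +
      ∑ i ∈ Finset.range (k + 1), ε i / (τ i ^ 2 * B (i + 1))) * hs.weight_succ k - hε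

theorem smoothF_le_F_add (x : H) (k : ℕ) :
    P.smoothF S ydot (β (k + 1)) (xbar (k + 1)) ≤ P.F x +
      ((τ k ^ 2 * B (k + 1) * (1 / 2 * ‖x - xtilde 0‖ ^ 2 +
        ∑ i ∈ Finset.range (k + 1), ε i / (τ i ^ 2 * B (i + 1))) : ℝ) : EReal) := by
  by_cases htop : P.F x = ⊤
  · rw [htop, EReal.top_add_coe]
    exact le_top
  have hbot : P.F x ≠ ⊥ := by
    simp [Problem.F, P.g_proper.1 x, P.h_proper.1 (P.M x)]
  obtain ⟨v, hv⟩ : ∃ v : ℝ, P.F x = v := ⟨_, (EReal.coe_toReal htop hbot).symm⟩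
  refine (hs.smoothF_le_of_F_le hstep hv.le k).trans ?_
  rw [hv, ← EReal.coe_add, EReal.coe_le_coe_iff]
  gcongr
  · exact (hs.weight_pos k).le
  · exact sub_le_self _ (by positivity)

end IsAcceleratedSchedule

end Schedule

section Linearized

variable {H G : Type*} [NormedAddCommGroup H] [InnerProductSpace ℝ H] [CompleteSpace H]
  [NormedAddCommGroup G] [InnerProductSpace ℝ G] [CompleteSpace G]
  {P : Problem H G} {S : G →L[ℝ] G} {ydot : G} {τ β B : ℕ → ℝ}

theorem Problem.Lf_add_normM_sq_pos (hS : IsPositiveDefinite S) (h : 0 < P.Lf ∨ P.M ≠ 0) :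
    0 < P.Lf + P.normM S ^ 2 := by
  rcases h with h | h
  · positivity
  · exact add_pos_of_nonneg_of_pos P.Lf_nonneg (pow_pos (P.normM_pos hS h) 2)

theorem Problem.IsNextTau.one_sub_mul {b t t' : ℝ} (h : P.IsNextTau b t t') (hb : b ≠ 0) :
    t' ^ 2 * (b + (b - P.Lf) * t') = (1 - t') * (t ^ 2 * b) := by
  have hroot := h.2
  field_simp at hroot
  linear_combination hroot

theorem Problem.IsNextTau.le_one {b t t' : ℝ} (h : P.IsNextTau b t t') (hb : 0 < b)
    (hLb : P.Lf ≤ b) (ht : 0 < t) : t' ≤ 1 := by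
  have ht' := h.1
  have hprod : 0 < (1 - t') * (t ^ 2 * b) := by
    rw [← h.one_sub_mul hb.ne']
    have := sub_nonneg.2 hLb
    positivity
  exact sub_nonneg.1 (pos_of_mul_pos_left hprod (by positivity)).le

theorem Problem.IsNextTau.le_mul_one_add {b t t' : ℝ} (h : P.IsNextTau b t t') (hb : 0 < b)
    (hLb : P.Lf ≤ b) (ht : 0 < t) : t ≤ t' * (1 + t) := by
  have ht' := h.1
  have ht'_le_one := h.le_one hb hLb ht
  have hsq : (t * (1 - t')) ^ 2 ≤ t' ^ 2 := by
    refine le_of_mul_le_mul_right ?_ hb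
    calc (t * (1 - t')) ^ 2 * b = (1 - t') * ((1 - t') * (t ^ 2 * b)) := by ring
      _ = (1 - t') * (t' ^ 2 * (b + (b - P.Lf) * t')) := by rw [h.one_sub_mul hb.ne']
      _ ≤ (1 - t') * (t' ^ 2 * (b + b * t')) := by
          gcongr
          exact sub_le_self b P.Lf_nonneg
      _ = t' ^ 2 * b * (1 - t' ^ 2) := by ring
      _ ≤ t' ^ 2 * b := mul_le_of_le_one_right (by positivity) (by linarith [sq_nonneg t'])
  linarith [abs_le_of_sq_le_sq' hsq ht'.le]

/-- The parameter rules common to linearized ASGARD with and without old gradients. -/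
structure Problem.IsCubicSchedule (P : Problem H G) (S : G →L[ℝ] G) (τ β B : ℕ → ℝ) : Prop where
  tau_zero : τ 0 = 1
  beta_zero : 0 < β 0
  beta_succ : ∀ k, β (k + 1) = β k / (1 + τ k)
  B_succ : ∀ k, B (k + 1) = P.Lf + P.normM S ^ 2 / β (k + 1)
  tau_succ : ∀ k, P.IsNextTau (B (k + 1)) (τ k) (τ (k + 1))

namespace Problem.IsCubicSchedule

variable (hs : P.IsCubicSchedule S τ β B)
include hs

theorem tau_pos : ∀ k, 0 < τ k
  | 0 => hs.tau_zero ▸ one_pos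
  | k + 1 => (hs.tau_succ k).1

theorem beta_pos : ∀ k, 0 < β k
  | 0 => hs.beta_zero
  | k + 1 => by
    rw [hs.beta_succ]
    have := hs.tau_pos k
    exact div_pos (beta_pos k) (by positivity)

theorem Lf_le (k : ℕ) : P.Lf ≤ B (k + 1) := by
  rw [hs.B_succ]
  have := hs.beta_pos (k + 1)
  exact le_add_of_nonneg_right (by positivity)

theorem B_pos (hpos : 0 < P.Lf + P.normM S ^ 2) (k : ℕ) : 0 < B (k + 1) := by
  have hβ := hs.beta_pos (k + 1)
  rw [hs.B_succ]
  rcases P.Lf_nonneg.eq_or_lt with hL | hL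
  · rw [← hL, zero_add] at hpos ⊢
    positivity
  · positivity

theorem B_succ_succ (k : ℕ) : B (k + 2) = B (k + 1) + (B (k + 1) - P.Lf) * τ (k + 1) := by
  have hβ := hs.beta_pos (k + 1)
  have := hs.tau_pos (k + 1)
  rw [hs.B_succ (k + 1), hs.B_succ k, hs.beta_succ (k + 1)]
  field_simp
  ring

theorem isAcceleratedSchedule (hpos : 0 < P.Lf + P.normM S ^ 2) :
    IsAcceleratedSchedule τ β B where
  tau_zero := hs.tau_zero
  tau_pos := hs.tau_pos
  beta_zero := hs.beta_zero
  beta_succ := hs.beta_succ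
  B_pos := hs.B_pos hpos
  weight_succ k := by
    rw [hs.B_succ_succ, (hs.tau_succ k).one_sub_mul (hs.B_pos hpos k).ne']

theorem one_div_le_tau (hpos : 0 < P.Lf + P.normM S ^ 2) (k : ℕ) : 1 / ((k : ℝ) + 1) ≤ τ k := by
  induction k with
  | zero => simp [hs.tau_zero]
  | succ k ih =>
    have hτ := hs.tau_pos k
    have hnext := (hs.tau_succ k).le_mul_one_add (hs.B_pos hpos k) (hs.Lf_le k) hτ
    push_cast
    calc 1 / ((k : ℝ) + 1 + 1) = 1 - 1 / (1 + 1 / ((k : ℝ) + 1)) := by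
          field_simp
          ring
      _ ≤ 1 - 1 / (1 + τ k) := by gcongr
      _ = τ k / (1 + τ k) := by
          field_simp
          ring
      _ ≤ τ (k + 1) := (div_le_iff₀ (by positivity)).2 hnext

theorem weight_le_div (hpos : 0 < P.Lf + P.normM S ^ 2) (k : ℕ) :
    τ k ^ 2 * B (k + 1) ≤ B 1 / ((k : ℝ) + 1) :=
  (hs.isAcceleratedSchedule hpos).weight_le_div (hs.one_div_le_tau hpos) k

end Problem.IsCubicSchedule

theorem IsLinearized.isCubicSchedule {xbar xtilde xhat : ℕ → H} {y : ℕ → G}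
    (hrun : IsLinearized P S ydot τ β B xbar xtilde xhat y) : P.IsCubicSchedule S τ β B :=
  ⟨hrun.tau_zero, hrun.beta_zero, hrun.beta_succ, hrun.B_succ, hrun.tau_succ⟩

theorem IsLinearized.isAcceleratedStep (hS : IsPositiveDefinite S) {xbar xtilde xhat : ℕ → H}
    {y : ℕ → G} (hrun : IsLinearized P S ydot τ β B xbar xtilde xhat y) (k : ℕ) :
    P.IsAcceleratedStep S ydot (τ k) (β (k + 1)) (B (k + 1)) 0
      (xbar k) (xtilde k) (xbar (k + 1)) (xtilde (k + 1)) where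
  bar := hrun.bar_succ k
  exists_model := ⟨xhat k, y k, hrun.tilde_succ k, hrun.hat k ▸
    Problem.hasUpperModel_of_isSmoothArgmax hS (hrun.isCubicSchedule.beta_pos _) (hrun.dual k)
      (hrun.B_succ k).ge (add_zero _).ge⟩

theorem IsLinearized.smoothF_le (hS : IsPositiveDefinite S) (hpos : 0 < P.Lf + P.normM S ^ 2)
    {xbar xtilde xhat : ℕ → H} {y : ℕ → G}
    (hrun : IsLinearized P S ydot τ β B xbar xtilde xhat y) (x : H) (k : ℕ) :
    P.smoothF S ydot (β (k + 1)) (xbar (k + 1)) ≤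
      P.F x + ((B 1 / (2 * ((k : ℝ) + 1)) * ‖x - xtilde 0‖ ^ 2 : ℝ) : EReal) := by
  have hs := hrun.isCubicSchedule
  refine ((hs.isAcceleratedSchedule hpos).smoothF_le_F_add (ε := fun _ => 0)
    (hrun.isAcceleratedStep hS) x k).trans
      (add_le_add_right (EReal.coe_le_coe_iff.2 ?_) _)
  calc τ k ^ 2 * B (k + 1) * (1 / 2 * ‖x - xtilde 0‖ ^ 2 +
        ∑ i ∈ Finset.range (k + 1), 0 / (τ i ^ 2 * B (i + 1)))
      = τ k ^ 2 * B (k + 1) * (1 / 2 * ‖x - xtilde 0‖ ^ 2) := by simp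
    _ ≤ B 1 / ((k : ℝ) + 1) * (1 / 2 * ‖x - xtilde 0‖ ^ 2) := by
        gcongr
        exact hs.weight_le_div hpos k
    _ = B 1 / (2 * ((k : ℝ) + 1)) * ‖x - xtilde 0‖ ^ 2 := by
        field_simp

section OldGradient

variable {σ δ : ℝ} {xbar xtilde xhat xold xtrial : ℕ → H} {y : ℕ → G}

theorem IsOldGradient.isCubicSchedule
    (hrun : IsOldGradient P S ydot σ δ τ β B xbar xtilde xhat xold xtrial y) :
    P.IsCubicSchedule S τ β B :=
  ⟨hrun.tau_zero, hrun.beta_zero, hrun.beta_succ, hrun.B_succ, hrun.tau_succ⟩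

theorem IsOldGradient.isAcceleratedStep (hS : IsPositiveDefinite S) (hL : 0 < P.Lf) (hσ : 0 ≤ σ)
    (hrun : IsOldGradient P S ydot σ δ τ β B xbar xtilde xhat xold xtrial y) (k : ℕ) :
    P.IsAcceleratedStep S ydot (τ k) (β (k + 1)) (B (k + 1))
      (P.Lf * (σ * (τ k ^ 2 * B (k + 1) / P.Lf) ^ (2 + δ)))
      (xbar k) (xtilde k) (xbar (k + 1)) (xtilde (k + 1)) := by
  refine ⟨hrun.bar_succ k, ?_⟩
  have hmodel {r : H} (hε : P.Lf / 2 * ‖xbar (k + 1) - r‖ ^ 2 ≤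
      P.Lf / 2 * ‖xbar (k + 1) - xhat k‖ ^ 2 +
        P.Lf * (σ * (τ k ^ 2 * B (k + 1) / P.Lf) ^ (2 + δ))) :=
    Problem.hasUpperModel_of_isSmoothArgmax hS (hrun.isCubicSchedule.beta_pos _) (hrun.dual k)
      (hrun.B_succ k).ge hε
  rw [← hrun.hat k]
  by_cases htest : P.OldGradientTest σ δ (τ k) (B (k + 1)) (xhat k) (xold k)
      ((1 - τ k) • xbar k + τ k • xtrial k)
  · have htilde := (hrun.accept k htest).2
    rw [← htilde, ← hrun.bar_succ, Problem.OldGradientTest] at htest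
    refine ⟨xold k, y k, htilde ▸ hrun.trial k, hmodel ?_⟩
    linarith [mul_le_mul_of_nonneg_left htest hL.le]
  · refine ⟨xhat k, y k, (hrun.reject k htest).2, hmodel (le_add_of_nonneg_right ?_)⟩
    have := hrun.isCubicSchedule.Lf_le k
    have : 0 < B (k + 1) := by linarith
    positivity

theorem sum_old_gradient_error_le {c : ℕ → ℝ} {L b : ℝ} (hL : 0 < L) (hσ : 0 ≤ σ) (hδ : 0 < δ)
    (hc : ∀ i, 0 < c i) (hcb : ∀ i : ℕ, c i ≤ b / ((i : ℝ) + 1)) (n : ℕ) :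
    ∑ i ∈ Finset.range n, L * (σ * (c i / L) ^ (2 + δ)) / c i ≤
      σ * (b / L) ^ (1 + δ) * ∑' i : ℕ, 1 / ((i : ℝ) + 1) ^ (1 + δ) := by
  have hb : 0 < b := by simpa using (hc 0).trans_le (hcb 0)
  have hterm (i : ℕ) : L * (σ * (c i / L) ^ (2 + δ)) / c i ≤
      σ * (b / L) ^ (1 + δ) * (1 / ((i : ℝ) + 1) ^ (1 + δ)) := by
    have hci := hc i
    calc L * (σ * (c i / L) ^ (2 + δ)) / c i = σ * (c i / L) ^ (1 + δ) := by
          rw [show 2 + δ = 1 + δ + 1 by ring, Real.rpow_add_one (by positivity)]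
          field_simp
      _ ≤ σ * (b / ((i : ℝ) + 1) / L) ^ (1 + δ) := by
          gcongr
          exact hcb i
      _ = σ * (b / L) ^ (1 + δ) * (1 / ((i : ℝ) + 1) ^ (1 + δ)) := by
          rw [div_right_comm, Real.div_rpow (by positivity) (by positivity)]
          ring
  have hsummable : Summable fun i : ℕ => 1 / ((i : ℝ) + 1) ^ (1 + δ) := by
    simpa using (summable_nat_add_iff 1).2
      (Real.summable_one_div_nat_rpow.2 (lt_add_of_pos_right 1 hδ))
  refine (Finset.sum_le_sum fun i _ => hterm i).trans ?_
  rw [← Finset.mul_sum]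
  gcongr
  exact hsummable.sum_le_tsum _ fun i _ => by positivity

theorem IsOldGradient.smoothF_le (hS : IsPositiveDefinite S) (hL : 0 < P.Lf) (hσ : 0 ≤ σ)
    (hδ : 0 < δ) (hrun : IsOldGradient P S ydot σ δ τ β B xbar xtilde xhat xold xtrial y) (x : H)
    (k : ℕ) :
    P.smoothF S ydot (β (k + 1)) (xbar (k + 1)) ≤ P.F x +
      ((B 1 / ((k : ℝ) + 1) * (1 / 2 * ‖x - xtilde 0‖ ^ 2 +
        σ * (B 1 / P.Lf) ^ (1 + δ) * ∑' i : ℕ, 1 / ((i : ℝ) + 1) ^ (1 + δ)) : ℝ) : EReal) := by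
  have hpos : 0 < P.Lf + P.normM S ^ 2 := by positivity
  have hcubic := hrun.isCubicSchedule
  have hs := hcubic.isAcceleratedSchedule hpos
  refine (hs.smoothF_le_F_add (hrun.isAcceleratedStep hS hL hσ) x k).trans
    (add_le_add_right (EReal.coe_le_coe_iff.2 ?_) _)
  have hB := hs.B_pos 0
  have herror := sum_old_gradient_error_le hL hσ hδ hs.weight_pos (hcubic.weight_le_div hpos)
    (k + 1)
  have : 0 ≤ ∑' i : ℕ, 1 / ((i : ℝ) + 1) ^ (1 + δ) :=
    tsum_nonneg fun i => by positivity
  exact (mul_le_mul_of_nonneg_left (add_le_add_right herror _) (hs.weight_pos k).le).trans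
    (mul_le_mul_of_nonneg_right (hcubic.weight_le_div hpos k) (by positivity))

end OldGradient

end Linearized

section LineSearch

variable {H G : Type*} [NormedAddCommGroup H] [InnerProductSpace ℝ H] [CompleteSpace H]
  [NormedAddCommGroup G] [InnerProductSpace ℝ G] [CompleteSpace G]
  {P : Problem H G} {S : G →L[ℝ] G} {ydot : G} {a : ℝ} {τ β B : ℕ → ℝ}
  {xbar xtilde xhat : ℕ → H} {y : ℕ → G}

theorem lineSearchTau_pos {k : ℕ} {b t : ℝ} (ht : lineSearchTau τ B k b t) : 0 < t := by
  cases k with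
  | zero => exact one_pos.trans_eq (Eq.symm ht)
  | succ k => exact ht.1

namespace IsLineSearch

variable (hrun : IsLineSearch P S ydot a τ β B xbar xtilde xhat y)
include hrun

theorem a_pos : 0 < a :=
  one_pos.trans hrun.one_lt_a

theorem B_pos (k : ℕ) : 0 < B k := by
  have ha := hrun.a_pos
  induction k with
  | zero => exact hrun.B_zero_pos
  | succ k ih =>
    obtain ⟨n, hn, -⟩ := hrun.step k
    rw [hn]
    positivity

theorem B_le_succ (k : ℕ) : B k ≤ B (k + 1) := by
  obtain ⟨n, hn, -⟩ := hrun.step k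
  rw [hn]
  exact le_mul_of_one_le_left (hrun.B_pos k).le (one_le_pow₀ hrun.one_lt_a.le)

theorem tau_rule (k : ℕ) : lineSearchTau τ B k (B (k + 1)) (τ k) := by
  obtain ⟨n, -, -, hc, -⟩ := hrun.step k
  exact hc.tau

theorem isAcceleratedSchedule : IsAcceleratedSchedule τ β B where
  tau_zero := hrun.tau_rule 0
  tau_pos k := lineSearchTau_pos (hrun.tau_rule k)
  beta_zero := hrun.beta_zero
  beta_succ k := by
    obtain ⟨n, -, -, hc, -⟩ := hrun.step k
    exact hc.beta
  B_pos k := hrun.B_pos (k + 1)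
  weight_succ k := by
    have hweight (k : ℕ) : τ k ^ 2 * B (k + 1) ≠ 0 :=
      (mul_pos (pow_pos (lineSearchTau_pos (hrun.tau_rule k)) 2) (hrun.B_pos (k + 1))).ne'
    have hτ := (hrun.tau_rule (k + 1)).2
    rw [div_eq_div_iff (hweight (k + 1)) (hweight k), one_mul] at hτ
    exact hτ.symm

theorem lineSearchTau_le_one {k : ℕ} {b t : ℝ} (hb : 0 < b) (ht : lineSearchTau τ B k b t) :
    t ≤ 1 := by
  cases k with
  | zero => exact le_of_eq ht
  | succ k =>
    obtain ⟨ht₀, ht⟩ := ht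
    have hdiv : 0 < (1 - t) / (t ^ 2 * b) :=
      ht ▸ one_div_pos.2 (hrun.isAcceleratedSchedule.weight_pos k)
    exact sub_nonneg.1 ((div_pos_iff_of_pos_right (by positivity)).1 hdiv).le

theorem trial_B_lt (hS : IsPositiveDefinite S) {k : ℕ} {t : Trial H G} (ht : 0 < t.B)
    (hc : t.IsComputed P S ydot (lineSearchTau τ B k) (β k) (xbar k) (xtilde k))
    (hfail : ¬ t.Passes P S ydot) : t.B < P.Lf + 2 * P.normM S ^ 2 / β k := by
  have hτ := lineSearchTau_pos hc.tau
  have hτ₁ := hrun.lineSearchTau_le_one ht hc.tau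
  have hβ := hrun.isAcceleratedSchedule.beta_pos k
  have htβ : 0 < t.β := by
    rw [hc.beta]
    positivity
  calc t.B < P.Lf + P.normM S ^ 2 / t.β :=
        not_le.1 fun hle => hfail (Trial.passes_of_le hS htβ hc.dual hle)
    _ = P.Lf + (1 + t.τ) * P.normM S ^ 2 / β k := by rw [hc.beta, div_div_eq_mul_div, mul_comm]
    _ ≤ P.Lf + 2 * P.normM S ^ 2 / β k := by
        gcongr
        linarith

theorem B_le (hS : IsPositiveDefinite S) (k : ℕ) :
    B k ≤ a * (P.Lf + 2 * P.normM S ^ 2 / β k) := by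
  have ha := hrun.a_pos
  have hs := hrun.isAcceleratedSchedule
  induction k with
  | zero =>
    have hβ := hrun.beta_zero
    refine hrun.B_zero_le.trans ?_
    gcongr
    exact le_mul_of_one_le_left (sq_nonneg _) one_le_two
  | succ k ih =>
    have hβ := hs.beta_pos (k + 1)
    suffices B (k + 1) ≤ a * (P.Lf + 2 * P.normM S ^ 2 / β k) by
      refine this.trans ?_
      gcongr
      exact hs.beta_succ_le k
    obtain ⟨n, hn, hfail, -⟩ := hrun.step k
    cases n with
    | zero => simpa [hn] using ih
    | succ m =>
      obtain ⟨t, htB, hc, hnot⟩ := hfail m m.lt_succ_self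
      have hBk := hrun.B_pos k
      have ht : 0 < t.B := by
        rw [htB]
        positivity
      rw [hn, pow_succ', mul_assoc, ← htB]
      exact mul_le_mul_of_nonneg_left (hrun.trial_B_lt hS ht hc hnot).le ha.le

theorem B_mul_beta_le (hS : IsPositiveDefinite S) (k : ℕ) :
    B k * β k ≤ a * (P.Lf * β 0 + 2 * P.normM S ^ 2) := by
  have ha := hrun.a_pos
  have hs := hrun.isAcceleratedSchedule
  have hβ := hs.beta_pos k
  calc B k * β k ≤ a * (P.Lf + 2 * P.normM S ^ 2 / β k) * β k := by
        gcongr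
        exact hrun.B_le hS k
    _ = a * (P.Lf * β k + 2 * P.normM S ^ 2) := by field_simp
    _ ≤ a * (P.Lf * β 0 + 2 * P.normM S ^ 2) := by
        gcongr
        · exact P.Lf_nonneg
        · exact antitone_nat_of_succ_le hs.beta_succ_le k.zero_le

theorem mul_beta_div_le (hS : IsPositiveDefinite S) (k : ℕ) :
    B 1 * β (k + 1) / β 0 ≤
      6 * (a * (P.Lf * β 0 + 2 * P.normM S ^ 2)) / β 0 / ((k : ℝ) + 1) := by
  rw [div_right_comm]
  exact div_le_div_of_nonneg_right (hrun.isAcceleratedSchedule.mul_beta_le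
    (fun k => hrun.B_le_succ (k + 1)) (fun k => hrun.B_mul_beta_le hS (k + 1)) k)
    hrun.beta_zero.le

theorem isAcceleratedStep (k : ℕ) :
    P.IsAcceleratedStep S ydot (τ k) (β (k + 1)) (B (k + 1)) 0
      (xbar k) (xtilde k) (xbar (k + 1)) (xtilde (k + 1)) := by
  obtain ⟨n, -, -, hc, hpass⟩ := hrun.step k
  exact ⟨hc.bar, xhat k, y k, hc.tilde, hc.hat ▸ (Trial.passes_iff hc.dual).1 hpass⟩

theorem smoothF_le (x : H) (k : ℕ) :
    P.smoothF S ydot (β (k + 1)) (xbar (k + 1)) ≤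
      P.F x + ((B 1 * β (k + 1) / β 0 * ‖x - xtilde 0‖ ^ 2 : ℝ) : EReal) := by
  have hs := hrun.isAcceleratedSchedule
  refine (hs.smoothF_le_F_add (ε := fun _ => 0) hrun.isAcceleratedStep x k).trans
    (add_le_add_right (EReal.coe_le_coe_iff.2 ?_) _)
  calc τ k ^ 2 * B (k + 1) * (1 / 2 * ‖x - xtilde 0‖ ^ 2 +
        ∑ i ∈ Finset.range (k + 1), 0 / (τ i ^ 2 * B (i + 1)))
      = τ k ^ 2 * B (k + 1) * (1 / 2 * ‖x - xtilde 0‖ ^ 2) := by simp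
    _ ≤ 2 * (B 1 * β (k + 1) / β 0) * (1 / 2 * ‖x - xtilde 0‖ ^ 2) :=
        mul_le_mul_of_nonneg_right (hs.weight_le k) (by positivity)
    _ = B 1 * β (k + 1) / β 0 * ‖x - xtilde 0‖ ^ 2 := by ring

end IsLineSearch

end LineSearch

theorem Problem.sub_optVal_le {H G : Type*}
    [NormedAddCommGroup H] [InnerProductSpace ℝ H] [CompleteSpace H]
    [NormedAddCommGroup G] [InnerProductSpace ℝ G] [CompleteSpace G]
    {P : Problem H G} {x : H} (hx : x ∈ P.minimizers) {u r : EReal} (h : u ≤ P.F x + r) :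
    u - P.optVal ≤ r := by
  have hopt : P.optVal = P.F x := le_antisymm (iInf_le _ x) (le_iInf (isMinOn_univ_iff.1 hx))
  exact EReal.sub_le_of_le_add' (h.trans_eq (by rw [hopt]))

end Asgard

theorem proposition1_general {H G : Type*}
    [NormedAddCommGroup H] [InnerProductSpace ℝ H] [CompleteSpace H]
    [NormedAddCommGroup G] [InnerProductSpace ℝ G] [CompleteSpace G]
    (P : Asgard.Problem H G) (S : G →L[ℝ] G) (hS : Asgard.IsPositiveDefinite S) (ydot : G) :
    ((0 < P.Lf ∨ P.M ≠ 0) →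
      ∀ (τ β B : ℕ → ℝ) (xbar xtilde xhat : ℕ → H) (y : ℕ → G),
        Asgard.IsLinearized P S ydot τ β B xbar xtilde xhat y →
        ∀ (x : H) (k : ℕ),
          P.smoothF S ydot (β (k + 1)) (xbar (k + 1)) ≤
            P.F x + ((B 1 / (2 * ((k : ℝ) + 1)) * ‖x - xtilde 0‖ ^ 2 : ℝ) : EReal)) ∧
    (0 < P.Lf →
      ∀ (σ δ : ℝ), 0 ≤ σ → 0 < δ →
      ∀ (τ β B : ℕ → ℝ) (xbar xtilde xhat xold xtrial : ℕ → H) (y : ℕ → G),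
        Asgard.IsOldGradient P S ydot σ δ τ β B xbar xtilde xhat xold xtrial y →
        ∀ (x : H) (k : ℕ),
          P.smoothF S ydot (β (k + 1)) (xbar (k + 1)) ≤
            P.F x + ((B 1 / ((k : ℝ) + 1) *
              (1 / 2 * ‖x - xtilde 0‖ ^ 2 +
                σ * (B 1 / P.Lf) ^ (1 + δ) *
                  ∑' i : ℕ, 1 / ((i : ℝ) + 1) ^ (1 + δ)) : ℝ) : EReal)) ∧
    (∀ (a β₀ : ℝ), ∃ C : ℝ,
      ∀ (τ β B : ℕ → ℝ) (xbar xtilde xhat : ℕ → H) (y : ℕ → G),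
        Asgard.IsLineSearch P S ydot a τ β B xbar xtilde xhat y → β 0 = β₀ →
        ∀ (x : H) (k : ℕ),
          P.smoothF S ydot (β (k + 1)) (xbar (k + 1)) ≤
            P.F x + ((B 1 * β (k + 1) / β 0 * ‖x - xtilde 0‖ ^ 2 : ℝ) : EReal) ∧
          B 1 * β (k + 1) / β 0 * ‖x - xtilde 0‖ ^ 2 ≤
            C * ‖x - xtilde 0‖ ^ 2 / ((k : ℝ) + 1)) := by
  refine ⟨fun hLM τ β B xbar xtilde xhat y hrun =>
      hrun.smoothF_le hS (Asgard.Problem.Lf_add_normM_sq_pos hS hLM),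
    fun hL σ δ hσ hδ τ β B xbar xtilde xhat xold xtrial y hrun => hrun.smoothF_le hS hL hσ hδ,
    fun a β₀ => ⟨6 * (a * (P.Lf * β₀ + 2 * P.normM S ^ 2)) / β₀, ?_⟩⟩
  rintro τ β B xbar xtilde xhat y hrun rfl x k
  refine ⟨hrun.smoothF_le x k, ?_⟩
  rw [mul_div_right_comm _ (_ ^ 2)]
  exact mul_le_mul_of_nonneg_right (hrun.mul_beta_div_le hS k) (sq_nonneg _)

theorem proposition1 {H G : Type*}
    [NormedAddCommGroup H] [InnerProductSpace ℝ H] [CompleteSpace H]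
    [NormedAddCommGroup G] [InnerProductSpace ℝ G] [CompleteSpace G]
    (P : Asgard.Problem H G) (S : G →L[ℝ] G) (hS : Asgard.IsPositiveDefinite S) (ydot : G) :
    -- linearized ASGARD
    ((0 < P.Lf ∨ P.M ≠ 0) →
      ∀ (τ β B : ℕ → ℝ) (xbar xtilde xhat : ℕ → H) (y : ℕ → G),
        Asgard.IsLinearized P S ydot τ β B xbar xtilde xhat y →
        ∀ xstar ∈ P.minimizers, ∀ k : ℕ,
          P.smoothF S ydot (β (k + 1)) (xbar (k + 1)) - P.optVal ≤
            ((B 1 / (2 * ((k : ℝ) + 1)) * ‖xstar - xtilde 0‖ ^ 2 : ℝ) : EReal)) ∧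
    -- linearized ASGARD with old gradients
    (0 < P.Lf →
      ∀ (σ δ : ℝ), 0 < σ → 0 < δ →
      ∀ (τ β B : ℕ → ℝ) (xbar xtilde xhat xold xtrial : ℕ → H) (y : ℕ → G),
        Asgard.IsOldGradient P S ydot σ δ τ β B xbar xtilde xhat xold xtrial y →
        ∀ xstar ∈ P.minimizers, ∀ k : ℕ,
          P.smoothF S ydot (β (k + 1)) (xbar (k + 1)) - P.optVal ≤
            ((B 1 / ((k : ℝ) + 1) *
              (1 / 2 * ‖xstar - xtilde 0‖ ^ 2 +
                σ * (B 1 / P.Lf) ^ (1 + δ) *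
                  ∑' i : ℕ, 1 / ((i : ℝ) + 1) ^ (1 + δ)) : ℝ) : EReal)) ∧
    -- linearized ASGARD with line search
    (∀ (a β₀ : ℝ), ∃ C : ℝ,
      ∀ (τ β B : ℕ → ℝ) (xbar xtilde xhat : ℕ → H) (y : ℕ → G),
        Asgard.IsLineSearch P S ydot a τ β B xbar xtilde xhat y → β 0 = β₀ →
        ∀ xstar ∈ P.minimizers, ∀ k : ℕ,
          P.smoothF S ydot (β (k + 1)) (xbar (k + 1)) - P.optVal ≤
            ((B 1 * β (k + 1) / β 0 * ‖xstar - xtilde 0‖ ^ 2 : ℝ) : EReal) ∧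
          B 1 * β (k + 1) / β 0 * ‖xstar - xtilde 0‖ ^ 2 ≤
            C * ‖xstar - xtilde 0‖ ^ 2 / ((k : ℝ) + 1)) :=
  have ⟨hlin, hold, hsearch⟩ := proposition1_general P S hS ydot
  ⟨fun hLM τ β B xbar xtilde xhat y hrun _ hx k =>
      P.sub_optVal_le hx (hlin hLM τ β B xbar xtilde xhat y hrun _ k),
    fun hL σ δ hσ hδ τ β B xbar xtilde xhat xold xtrial y hrun _ hx k =>
      P.sub_optVal_le hx (hold hL σ δ hσ.le hδ τ β B xbar xtilde xhat xold xtrial y hrun _ k),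
    fun a β₀ => (hsearch a β₀).imp fun _ hC τ β B xbar xtilde xhat y hrun hβ₀ x hx k =>
      (hC τ β B xbar xtilde xhat y hrun hβ₀ x k).imp_left (P.sub_optVal_le hx)⟩
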